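/- A weighted oriented graph $D=(G,\mathcal O,w)$ consists of a finite simple graph $G$ with vertex set $V$, an orientation $\mathcal O$ of its edges (we write $(x,y)\in E(D)$ if $\{x,y\}\in E(G)$ is directed from $x$ to $y$), and a function $w:V\to\{1,2,3,\dots\}$. Put $V^+=\{x\in V: w(x)>1\}$, $N_D(x)=\{y:\{x,y\}\in E(G)\}$, $N_D^+(x)=\{y:(x,y)\in E(D)\}$ and $N_D^+(A)=\bigcup_{x\in A}N_D^+(x)$. Let $K$ be a field; the edge ideal of $D$ is the ideal $I(D)=(x\,y^{w(y)} : (x,y)\in E(D))$ of the polynomial ring $K[V]$ whose variables are the vertices. An ideal is unmixed if all its associated primes have the same height. A vertex $v$ is simplicial if $G[N_D(v)\cup\{v\}]$ is complete; this induced subgraph is then called a simplex of $G$ (and of $D$). $G$ is simplicial if every vertex is simplicial or adjacent to a simplicial vertex, and chordal if every induced cycle of $G$ is a $3$-cycle. A weighted oriented subgraph of $D$ is a subgraph of $G$ with the orientation and weights inherited from $D$; for such a subgraph $H$, $\deg_H(x)$ is the number of neighbours of $x$ in $H$. * A root oriented tree with parent $v$ is a weighted oriented subgraph $T$ of $D$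 without cycles, with $v\in V(T)$, such that for each $x\in V(T)\setminus\{v\}$ there is an oriented path in $T$ from $v$ to $x$, and for each $x\in V(T)$ with $w(x)=1$ either $\deg_T(x)=1$ and $x\ne v$, or $V(T)=\{v\}$ and $x=v$. * A unicycle oriented subgraph is a weighted oriented subgraph $B$ of $D$ with exactly one cycle $C$, such that $C$ is an oriented cycle, for each $y\in V(B)\setminus V(C)$ there is an oriented path in $B$ from a vertex of $C$ to $y$, and $\deg_B(x)=1$ for each $x\in V(B)$ with $w(x)=1$. * A $\star$-semi-forest of $D$ is a weighted oriented subgraph $H$ of $D$ that is the union of root oriented trees $T_1,\dots,T_r$ with parents $v_1,\dots,v_r$ and unicycle oriented subgraphs $B_1,\dots,B_s$ ($r,s\ge 0$) such that: (i) the vertex sets of the $T_i$ and $B_j$ partition $V(H)$; (ii) there are (not necessarily distinct) vertices $w_1,\dots,w_r\in V\setminus V(H)$ with $w_i\in N_D(v_i)$ for each $i$; (iii) $\{w_1,\dots,w_r\}$ is the disjoint union of two (possibly empty) sets $W_1$ and $W_2$ such that $W_1$ is stable (contains no edge of $G$), $W_2\subseteq V^+$, $(w_i,v_i)\in E(D)$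 whenever $w_i\in W_2$, and $N_D^+(W_2\cup\tilde H)\cap W_1=\emptyset$, where $\tilde H=\{x\in V(H):\deg_H(x)\ge 2\}\cup\{v_i:\deg_H(v_i)=1\}$. * A generating $\star$-semi-forest of a weighted oriented subgraph $S$ of $D$ is a $\star$-semi-forest $H$ of $D$ with $V(H)=V(S)$. **Corollary.** Let $D=(G,\mathcal O,w)$ be a weighted oriented graph such that $G$ is simplicial or chordal. Then $I(D)$ is unmixed if and only if both of the following hold: (a) each vertex lies in exactly one simplex of $D$; (b) no simplex of $D$ has a generating $\star$-semi-forest. -/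

import Mathlib

/-- A weighted oriented graph `(G, O, w)` on the vertex set `V`: a simple graph `G`, an orientation
of its edges (`Arc x y` says that `(x, y)` is an oriented edge), and positive integer weights. -/
structure WeightedOrientedGraph (V : Type*) where
  graph : SimpleGraph V
  Arc : V → V → Prop
  adj_iff : ∀ x y, graph.Adj x y ↔ Arc x y ∨ Arc y x
  arc_asymm : ∀ x y, Arc x y → ¬ Arc y x
  weight : V → ℕ
  weight_pos : ∀ x, 0 < weight x

/-- An ideal is unmixed if all its associated primes (those of the module `R ⧸ I`) have the same
height. -/
def Ideal.IsUnmixed {R : Type*} [CommRing R] (I : Ideal R) : Prop :=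
  ∀ P ∈ associatedPrimes R (R ⧸ I), ∀ Q ∈ associatedPrimes R (R ⧸ I), P.height = Q.height

namespace SimpleGraph

variable {V : Type*} (G : SimpleGraph V)

/-- The closed neighbourhood `N[v]`. -/
def closedNbhd (v : V) : Set V := insert v (G.neighborSet v)

/-- `v` is simplicial if `G[N[v]]` is complete. -/
def IsSimplicialVertex (v : V) : Prop := G.IsClique (G.closedNbhd v)

/-- A simplex of `G` is an induced subgraph `G[N[v]]` with `v` a simplicial vertex. -/
def IsSimplex (S : G.Subgraph) : Prop :=
  ∃ v, G.IsSimplicialVertex v ∧ S = (⊤ : G.Subgraph).induce (G.closedNbhd v)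

/-- Every vertex is simplicial or adjacent to a simplicial vertex. -/
def IsSimplicialGraph : Prop :=
  ∀ v, G.IsSimplicialVertex v ∨ ∃ u, G.Adj v u ∧ G.IsSimplicialVertex u

/-- Every induced cycle of `G` is a 3-cycle. -/
def IsChordalGraph : Prop :=
  ∀ (u : V) (c : G.Walk u u), c.IsCycle →
    (∀ x ∈ c.support, ∀ y ∈ c.support, G.Adj x y → s(x, y) ∈ c.edges) → c.length = 3

end SimpleGraph

namespace WeightedOrientedGraph

variable {V : Type*} (D : WeightedOrientedGraph V)

/-- The edge ideal `I(D) = (x_i x_j ^ w(x_j) | (x_i, x_j) ∈ E(D))` of `K[x | x ∈ V]`. -/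
noncomputable def edgeIdeal (K : Type*) [Field K] : Ideal (MvPolynomial V K) :=
  Ideal.span {f | ∃ x y, D.Arc x y ∧ f = MvPolynomial.X x * MvPolynomial.X y ^ D.weight y}

/-- The set `V⁺` of vertices of weight greater than one. -/
def heavy : Set V := {x | 1 < D.weight x}

/-- The out-neighbourhood `N⁺(A)` of a set of vertices. -/
def outNbhd (A : Set V) : Set V := {y | ∃ x ∈ A, D.Arc x y}

/-- A walk all of whose steps follow the orientation of `D`. -/
def IsOrientedWalk {H : SimpleGraph V} {u v : V} (p : H.Walk u v) : Prop :=
  ∀ d ∈ p.darts, D.Arc d.fst d.snd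

/- A weighted oriented subgraph of `D` carries the orientation and the weights of `D`, so it is
given by a subgraph of the underlying graph. -/

/-- The degree of `x` in a weighted oriented subgraph `H`. -/
noncomputable def deg (H : D.graph.Subgraph) (x : V) : ℕ := (H.neighborSet x).ncard

/-- `H` contains an oriented path from `u` to `v` (possibly of length zero). -/
def HasOrientedPath (H : D.graph.Subgraph) (u v : V) : Prop :=
  ∃ p : H.spanningCoe.Walk u v, p.IsPath ∧ D.IsOrientedWalk p

/-- Unicycle oriented subgraphs: `B` has exactly one cycle (as a subgraph, that is, up to the choice
of starting point and direction); it is an oriented cycle, every other vertex of `B` is reached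
from it by an oriented path in `B`, and vertices of weight one have degree one in `B`. -/
def IsUnicycle (B : D.graph.Subgraph) : Prop :=
  (∃ (u : V) (c : B.spanningCoe.Walk u u), c.IsCycle ∧
    (∀ (u' : V) (c' : B.spanningCoe.Walk u' u'), c'.IsCycle → c'.edgeSet = c.edgeSet) ∧
    D.IsOrientedWalk c ∧
    ∀ y ∈ B.verts, y ∉ c.support → ∃ z ∈ c.support, D.HasOrientedPath B z y) ∧
  ∀ x ∈ B.verts, D.weight x = 1 → D.deg B x = 1

/-- Root oriented trees with parent `v`. -/
def IsRootOrientedTree (T : D.graph.Subgraph) (v : V) : Prop :=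
  v ∈ T.verts ∧
  T.spanningCoe.IsAcyclic ∧
  (∀ x ∈ T.verts, x ≠ v → D.HasOrientedPath T v x) ∧
  ∀ x ∈ T.verts, D.weight x = 1 → (D.deg T x = 1 ∧ x ≠ v) ∨ (T.verts = {v} ∧ x = v)

/-- `⋆`-semi-forests of `D`: unions of root oriented trees `T i` with parents `v i` and unicycle
oriented subgraphs `B j`, pairwise vertex-disjoint, together with the vertices `w i` outside `H`
and the partition of the set of these into (possibly empty) `W₁` and `W₂`. -/
def IsStarSemiForest (H : D.graph.Subgraph) : Prop :=
  ∃ (r s : ℕ) (T : Fin r → D.graph.Subgraph) (v : Fin r → V) (B : Fin s → D.graph.Subgraph)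
    (w : Fin r → V) (W₁ W₂ : Set V),
    (∀ i, D.IsRootOrientedTree (T i) (v i)) ∧
    (∀ j, D.IsUnicycle (B j)) ∧
    H = (⨆ i, T i) ⊔ (⨆ j, B j) ∧
    -- (i) the vertex sets partition `V(H)`
    (∀ i i', i ≠ i' → Disjoint (T i).verts (T i').verts) ∧
    (∀ j j', j ≠ j' → Disjoint (B j).verts (B j').verts) ∧
    (∀ i j, Disjoint (T i).verts (B j).verts) ∧
    -- (ii)
    (∀ i, w i ∉ H.verts ∧ D.graph.Adj (v i) (w i)) ∧
    -- (iii)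
    W₁ ∪ W₂ = Set.range w ∧ Disjoint W₁ W₂ ∧
    D.graph.IsIndepSet W₁ ∧
    W₂ ⊆ D.heavy ∧
    (∀ i, w i ∈ W₂ → D.Arc (w i) (v i)) ∧
    D.outNbhd (W₂ ∪ ({x | x ∈ H.verts ∧ 2 ≤ D.deg H x} ∪ {x | ∃ i, x = v i ∧ D.deg H x = 1}))
      ∩ W₁ = ∅

/-- `H` is a generating `⋆`-semi-forest of the weighted oriented subgraph `K` of `D`. -/
def IsGeneratingStarSemiForest (H K : D.graph.Subgraph) : Prop :=
  D.IsStarSemiForest H ∧ K.verts = H.verts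

end WeightedOrientedGraph

/-! The statement reduces to counting strong vertex covers (`IsStrongCover`). A monomial outside
`I(D)` avoids one of the irreducible ideals `powIdeal K C (D.coverExp C)` with `C` a strong cover,
so `I(D)` is their intersection. Its associated primes are therefore the primes generated by the
strong covers, of height `|C|`, and unmixedness means that all strong covers have equal size
(`isUnmixed_edgeIdeal_iff`).

A vertex set lies in a strong cover exactly when it is the vertex set of a `⋆`-semi-forest
(`exists_isGeneratingStarSemiForest_iff`): sending a vertex to its heavy in-neighbour defines a
self-map whose fixed points root the trees and whose longer cycles give the unicycles. So (b) says
that no strong cover contains a simplex.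

If the simplices partition the vertices, a stable set has one vertex in each simplex that it meets.
Complements of strong covers are stable, and those of minimal covers meet every simplex; hence the
sizes agree iff no strong cover contains a simplex (`forall_isStrongCover_ncard_eq_iff`). Finally,
minimal covers are strong, so unmixedness makes `G` well-covered; a well-covered chordal graph is
simplicial, and in a well-covered simplicial graph the simplices partition the vertices. -/

namespace MvPolynomial

/-! ### Ideals generated by powers of variables -/

variable {σ K : Type*} [Field K]

/-- The ideal generated by the powers `x ^ e x` of the variables `x ∈ C`. -/
noncomputable def powIdeal (K : Type*) [Field K] (C : Set σ) (e : σ → ℕ) :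
    Ideal (MvPolynomial σ K) :=
  Ideal.span ((fun s => monomial s (1 : K)) '' ((fun x => Finsupp.single x (e x)) '' C))

theorem mem_powIdeal {C : Set σ} {e : σ → ℕ} {f : MvPolynomial σ K} :
    f ∈ powIdeal K C e ↔ ∀ m ∈ f.support, ∃ x ∈ C, e x ≤ m x := by
  simp [powIdeal, mem_ideal_span_monomial_image]

theorem monomial_mem_powIdeal {C : Set σ} {e : σ → ℕ} {m : σ →₀ ℕ} :
    monomial m (1 : K) ∈ powIdeal K C e ↔ ∃ x ∈ C, e x ≤ m x := by
  classical
  rw [mem_powIdeal, support_monomial, if_neg one_ne_zero]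
  simp

open Classical in
/-- The sum of the terms of `f` whose exponents satisfy `p`. -/
noncomputable def restrictTerms (p : (σ →₀ ℕ) → Prop) (f : MvPolynomial σ K) : MvPolynomial σ K :=
  ∑ m ∈ f.support with p m, monomial m (f.coeff m)

open Classical in
theorem coeff_restrictTerms (p : (σ →₀ ℕ) → Prop) (f : MvPolynomial σ K) (m : σ →₀ ℕ) :
    (restrictTerms p f).coeff m = if p m then f.coeff m else 0 := by
  simp only [restrictTerms, coeff_sum, coeff_monomial, Finset.sum_ite_eq', Finset.mem_filter,
    mem_support_iff]
  split_ifs <;> simp_all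

theorem restrictTerms_ne_zero {p : (σ →₀ ℕ) → Prop} {f : MvPolynomial σ K} {m : σ →₀ ℕ}
    (hm : m ∈ f.support) (hp : p m) : restrictTerms p f ≠ 0 := by
  intro h
  have := coeff_restrictTerms p f m
  rw [h, if_pos hp, coeff_zero] at this
  exact (mem_support_iff.mp hm) this.symm

/-- `powIdeal K C e` is primary to the ideal of the variables in `C`. -/
theorem mul_notMem_powIdeal {C : Set σ} {e : σ → ℕ} {f g : MvPolynomial σ K}
    (hg : g ∉ powIdeal K C 1) (hf : f ∉ powIdeal K C e) : g * f ∉ powIdeal K C e := by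
  classical
  -- `d` is the degree in the variables of `C`. The `d`-free part of `g` times the lowest-`d` part
  -- of the terms of `f` outside the ideal is nonzero, as polynomials form a domain.
  set d : (σ →₀ ℕ) →+ ℕ := Finsupp.weight (fun x => if x ∈ C then 1 else 0) with hd
  have hd0 : ∀ m x, d m = 0 → x ∈ C → m x = 0 := by
    intro m x hm hx
    have := Finsupp.le_weight (fun x => if x ∈ C then 1 else 0) (s := x) (by simp [hx]) m
    rw [← hd, hm] at this
    omega
  have hd1 : ∀ m, (∀ x ∈ C, m x = 0) → d m = 0 := by
    intro m hm
    rw [hd, Finsupp.weight_apply]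
    refine Finset.sum_eq_zero fun x _ => ?_
    by_cases hx : x ∈ C <;> simp [hx, hm]
  rw [mem_powIdeal] at hf hg
  push Not at hf hg
  obtain ⟨u₀, hu₀, hu₀C⟩ := hg
  obtain ⟨v₀, hv₀, hv₀min⟩ := Finset.exists_min_image
    (f.support.filter fun m => ∀ x ∈ C, m x < e x) d
    (by obtain ⟨v, hv, h⟩ := hf; exact ⟨v, Finset.mem_filter.mpr ⟨hv, h⟩⟩)
  rw [Finset.mem_filter] at hv₀
  have hne : restrictTerms (fun m => d m = 0) g *
      restrictTerms (fun m => (∀ x ∈ C, m x < e x) ∧ d m = d v₀) f ≠ 0 :=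
    mul_ne_zero (restrictTerms_ne_zero hu₀
      (hd1 _ fun x hx => by simpa using hu₀C x hx)) (restrictTerms_ne_zero hv₀.1 ⟨hv₀.2, rfl⟩)
  obtain ⟨m, hm⟩ := ne_zero_iff.mp hne
  have hmd : (∀ x ∈ C, m x < e x) ∧ d m = d v₀ := by
    rw [coeff_mul] at hm
    obtain ⟨⟨u, v⟩, huv, h⟩ := Finset.exists_ne_zero_of_sum_ne_zero hm
    rw [Finset.HasAntidiagonal.mem_antidiagonal] at huv
    simp only [coeff_restrictTerms] at h
    have h1 : d u = 0 := by
      by_contra h1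
      simp [h1] at h
    have h2 : (∀ x ∈ C, v x < e x) ∧ d v = d v₀ := by
      by_contra h2
      rw [if_neg h2, mul_zero] at h
      exact h rfl
    subst huv
    refine ⟨fun x hx => ?_, by simp [h1, h2.2]⟩
    simp [hd0 _ x h1 hx, h2.1 x hx]
  intro hmem
  rw [mem_powIdeal] at hmem
  -- The discarded terms do not affect the coefficient at `m`: if `u + v = m` with `v` in the
  -- support of `f`, then `v` is below `e` on `C`, so `d v ≥ d v₀ = d m`, which forces `d u = 0`.
  obtain ⟨x, hx, hex⟩ := hmem m (by
    rw [mem_support_iff]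
    convert hm using 1
    rw [coeff_mul, coeff_mul]
    refine Finset.sum_congr rfl fun ⟨u, v⟩ huv => ?_
    rw [Finset.HasAntidiagonal.mem_antidiagonal] at huv
    simp only at huv ⊢
    simp only [coeff_restrictTerms]
    by_cases hv : coeff v f = 0
    · simp [hv]
    have hvC : ∀ x ∈ C, v x < e x := fun x hx =>
      lt_of_le_of_lt (by rw [← huv]; simp) (hmd.1 x hx)
    have hle := hv₀min v (Finset.mem_filter.mpr ⟨mem_support_iff.mpr hv, hvC⟩)
    have hsum : d u + d v = d v₀ := by rw [← map_add, huv, hmd.2]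
    rw [if_pos (by omega), if_pos ⟨hvC, by omega⟩])
  exact absurd (hmd.1 x hx) (by omega)

theorem one_notMem_powIdeal (C : Set σ) : (1 : MvPolynomial σ K) ∉ powIdeal K C 1 := by
  rw [MvPolynomial.one_def, monomial_mem_powIdeal]
  simp

theorem isPrime_powIdeal_one (C : Set σ) : (powIdeal K C 1).IsPrime := by
  refine ⟨(Ideal.ne_top_iff_one _).mpr (one_notMem_powIdeal C), fun {x y} h => ?_⟩
  by_contra! hc
  exact mul_notMem_powIdeal hc.1 hc.2 h

theorem X_mem_powIdeal_one {C : Set σ} {x : σ} :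
    (X x : MvPolynomial σ K) ∈ powIdeal K C 1 ↔ x ∈ C := by
  classical
  rw [X, monomial_mem_powIdeal]
  simp only [Pi.one_apply, Finsupp.single_apply]
  constructor
  · rintro ⟨y, hy, h⟩
    split_ifs at h with hxy
    · exact hxy ▸ hy
    · omega
  · exact fun h => ⟨x, h, by simp⟩

theorem powIdeal_one_le_iff {C : Set σ} {I : Ideal (MvPolynomial σ K)} :
    powIdeal K C 1 ≤ I ↔ ∀ x ∈ C, X x ∈ I := by
  rw [powIdeal, Ideal.span_le, Set.image_image]
  simp [Set.subset_def, X]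

variable [Finite σ]

/-- Krull's height theorem bounds the height above; adjoining the variables one at a time gives a
chain of primes that bounds it below. -/
theorem height_powIdeal_one (C : Set σ) : (powIdeal K C 1).height = C.ncard := by
  have hp := isPrime_powIdeal_one (K := K) C
  apply le_antisymm
  · have h := Ideal.height_le_card_of_mem_minimalPrimes_span (p := powIdeal K C 1)
      (s := (fun s => monomial s (1 : K)) '' ((fun x => Finsupp.single x 1) '' C))
      (Set.toFinite _) (by
        change powIdeal K C 1 ∈ (powIdeal K C 1).minimalPrimes
        rw [Ideal.minimalPrimes_eq_subsingleton_self]; rfl)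
    refine h.trans ?_
    exact_mod_cast (Set.ncard_image_le (Set.toFinite _)).trans (Set.ncard_image_le (Set.toFinite _))
  · induction C, (Set.toFinite C) using Set.Finite.induction_on with
    | empty => simp
    | @insert a s ha hs ih =>
      have h1 := isPrime_powIdeal_one (K := K) s
      have hlt : powIdeal K s 1 < powIdeal K (insert a s) 1 := by
        refine lt_of_le_of_ne (powIdeal_one_le_iff.mpr fun x hx =>
          X_mem_powIdeal_one.mpr (Set.mem_insert_of_mem _ hx)) fun h => ha ?_
        rw [← X_mem_powIdeal_one (K := K), h, X_mem_powIdeal_one]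
        exact Set.mem_insert _ _
      rw [Set.ncard_insert_of_notMem ha hs]
      push_cast
      exact (add_le_add_left (ih h1) 1).trans
        (Ideal.height_add_one_le_of_lt_of_isPrime hlt)

end MvPolynomial

/-! ### Strong vertex covers and the associated primes of the edge ideal -/

namespace WeightedOrientedGraph

open MvPolynomial

variable {V : Type*} (D : WeightedOrientedGraph V)

theorem arc_irrefl (x : V) : ¬ D.Arc x x := fun h => D.arc_asymm x x h h

theorem adj_of_arc {x y : V} (h : D.Arc x y) : D.graph.Adj x y := (D.adj_iff x y).mpr (Or.inl h)

/-- Strong vertex covers: vertex covers `C` such that each vertex of `C` without neighbours outside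
`C` has a heavy in-neighbour in `C` all of whose out-neighbours lie in `C`. -/
def IsStrongCover (C : Set V) : Prop :=
  (∀ x y, D.Arc x y → x ∈ C ∨ y ∈ C) ∧
  ∀ x ∈ C, (∀ y, D.graph.Adj x y → y ∈ C) →
    ∃ y ∈ C, D.Arc y x ∧ 1 < D.weight y ∧ ∀ z, D.Arc y z → z ∈ C

open Classical in
/-- The exponents of the irreducible component of `I(D)` belonging to a vertex cover `C`. -/
noncomputable def coverExp (C : Set V) (x : V) : ℕ :=
  if ∃ z, D.Arc x z ∧ z ∉ C then 1 else D.weight x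

theorem one_le_coverExp (C : Set V) (x : V) : 1 ≤ D.coverExp C x := by
  unfold coverExp
  split_ifs
  exacts [le_rfl, D.weight_pos x]

theorem mem_edgeIdeal {K : Type*} [Field K] {f : MvPolynomial V K} :
    f ∈ D.edgeIdeal K ↔
      ∀ m ∈ f.support, ∃ x y, D.Arc x y ∧ 1 ≤ m x ∧ D.weight y ≤ m y := by
  classical
  have h : D.edgeIdeal K = Ideal.span ((fun s => monomial s (1 : K)) ''
      {s | ∃ x y, D.Arc x y ∧ s = Finsupp.single x 1 + Finsupp.single y (D.weight y)}) := by
    unfold edgeIdeal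
    congr 1
    ext f
    constructor
    · rintro ⟨x, y, hxy, rfl⟩
      exact ⟨_, ⟨x, y, hxy, rfl⟩, by simp [X, monomial_pow, monomial_mul]⟩
    · rintro ⟨_, ⟨x, y, hxy, rfl⟩, rfl⟩
      exact ⟨x, y, hxy, by simp [X, monomial_pow, monomial_mul]⟩
  rw [h, mem_ideal_span_monomial_image]
  refine forall₂_congr fun m _ => ?_
  constructor
  · rintro ⟨_, ⟨x, y, hxy, rfl⟩, hle⟩
    refine ⟨x, y, hxy, ?_, ?_⟩
    · have := hle x
      simp only [Finsupp.add_apply, Finsupp.single_eq_same] at this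
      omega
    · have := hle y
      simp only [Finsupp.add_apply, Finsupp.single_eq_same] at this
      omega
  · rintro ⟨x, y, hxy, hx, hy⟩
    refine ⟨_, ⟨x, y, hxy, rfl⟩, fun z => ?_⟩
    have hne : x ≠ y := fun h => D.arc_irrefl x (h ▸ hxy)
    rw [Finsupp.add_apply, Finsupp.single_apply, Finsupp.single_apply]
    split_ifs with h1 h2 h2 <;> subst_vars
    · exact absurd rfl hne
    · omega
    · omega
    · omega

/-- For an arc `(x, y)`, either `y ∈ C` and its exponent is at most `w(y)`, or `y ∉ C` and this very
arc makes the exponent of `x` equal to one. -/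
theorem edgeIdeal_le_powIdeal {K : Type*} [Field K] {C : Set V}
    (hC : ∀ x y, D.Arc x y → x ∈ C ∨ y ∈ C) :
    D.edgeIdeal K ≤ powIdeal K C (D.coverExp C) := by
  intro f hf
  rw [mem_edgeIdeal] at hf
  rw [mem_powIdeal]
  intro m hm
  obtain ⟨x, y, hxy, hx, hy⟩ := hf m hm
  by_cases hyC : y ∈ C
  · refine ⟨y, hyC, ?_⟩
    have := D.weight_pos y
    unfold coverExp
    split_ifs <;> omega
  · refine ⟨x, (hC x y hxy).resolve_right hyC, ?_⟩
    rwa [coverExp, if_pos ⟨y, hxy, hyC⟩]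

variable [Finite V]

/-- Every monomial outside `I(D)` avoids the irreducible component of some strong cover. -/
theorem exists_isStrongCover_of_monomial {m : V → ℕ}
    (hm : ∀ x y, D.Arc x y → ¬ (1 ≤ m x ∧ D.weight y ≤ m y)) :
    ∃ C, D.IsStrongCover C ∧ ∀ x ∈ C, m x < D.coverExp C x := by
  classical
  -- Raise the exponents on `Z` to at least the weights, with `Z` maximal such that the monomial
  -- stays outside `I(D)`. The cover is the complement of `Z`.
  let a : Set V → V → ℕ := fun Z x => if x ∈ Z then max (m x) (D.weight x) else m x
  obtain ⟨Z, -, hZ⟩ := (Set.toFinite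
    {Z : Set V | ∀ x y, D.Arc x y → ¬ (1 ≤ a Z x ∧ D.weight y ≤ a Z y)}).exists_le_maximal
      (a := ∅) (by simpa [a] using hm)
  have hZp := hZ.prop
  simp only [Set.mem_ofPred_eq] at hZp
  have hZw : ∀ x ∈ Z, D.weight x ≤ a Z x := fun x hx => by simp [a, hx]
  have hZ1 : ∀ x ∈ Z, 1 ≤ a Z x := fun x hx => (D.weight_pos x).trans_le (hZw x hx)
  have hnot : ∀ x ∉ Z, a Z x = m x := fun x hx => by simp [a, hx]
  have hext : ∀ x ∉ Z, ∃ y, (D.Arc x y ∧ D.weight y ≤ a Z y) ∨ (D.Arc y x ∧ 1 ≤ a Z y) := by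
    intro x hx
    by_contra! hcon
    refine hx (hZ.le_of_ge (y := insert x Z) ?_ (Set.subset_insert x Z) (Set.mem_insert x Z))
    intro u v huv ⟨hu, hv⟩
    have hne : u ≠ v := fun h => D.arc_irrefl u (h ▸ huv)
    have hoff : ∀ y, y ≠ x → a (insert x Z) y = a Z y := fun y hy => by simp [a, hy]
    by_cases hux : u = x
    · subst hux
      rw [hoff v hne.symm] at hv
      exact absurd hv (not_le.mpr ((hcon v).1 huv))
    · by_cases hvx : v = x
      · subst hvx
        rw [hoff u hne] at hu
        exact absurd hu (not_le.mpr ((hcon u).2 huv))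
      · rw [hoff u hux] at hu
        rw [hoff v hvx] at hv
        exact hZp u v huv ⟨hu, hv⟩
  have hlt : ∀ x ∉ Z, m x < D.weight x := by
    intro x hx
    by_contra! hle
    have hx1 : 1 ≤ a Z x := by rw [hnot x hx]; exact (D.weight_pos x).trans_le hle
    obtain ⟨y, ⟨h1, h2⟩ | ⟨h1, h2⟩⟩ := hext x hx
    · exact hZp x y h1 ⟨hx1, h2⟩
    · exact hZp y x h1 ⟨h2, by rwa [hnot x hx]⟩
  have hwZ : ∀ x, D.weight x ≤ a Z x → x ∈ Z := by
    intro x hx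
    by_contra h
    rw [hnot x h] at hx
    exact absurd (hlt x h) (by omega)
  refine ⟨Zᶜ, ⟨?_, ?_⟩, ?_⟩
  · intro x y hxy
    by_contra! h
    simp only [Set.mem_compl_iff, not_not] at h
    exact hZp x y hxy ⟨hZ1 x h.1, hZw y h.2⟩
  · intro x hx hN
    obtain ⟨y, ⟨h1, h2⟩ | ⟨h1, h2⟩⟩ := hext x hx
    · exact absurd (hwZ y h2) (hN y (D.adj_of_arc h1))
    -- `y` is heavy because `1 ≤ m y < w(y)`, and an out-neighbour of `y` in `Z` would put the
    -- raised monomial into `I(D)`.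
    · have hyZ : y ∉ Z := hN y (D.adj_of_arc h1).symm
      refine ⟨y, hyZ, h1, ?_, fun z hz hzZ => hZp y z hz ⟨h2, hZw z hzZ⟩⟩
      have := hlt y hyZ
      rw [hnot y hyZ] at h2
      omega
  · intro x hx
    unfold coverExp
    split_ifs with h
    · obtain ⟨z, hxz, hz⟩ := h
      simp only [Set.mem_compl_iff, not_not] at hz
      by_contra! hc
      exact hZp x z hxz ⟨by rwa [hnot x hx], hZw z hz⟩
    · exact hlt x hx

theorem mem_edgeIdeal_iff_forall_isStrongCover {K : Type*} [Field K] {f : MvPolynomial V K} :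
    f ∈ D.edgeIdeal K ↔ ∀ C, D.IsStrongCover C → f ∈ powIdeal K C (D.coverExp C) := by
  refine ⟨fun hf C hC => D.edgeIdeal_le_powIdeal hC.1 hf, fun h => ?_⟩
  rw [mem_edgeIdeal]
  intro m hm
  by_contra! hcon
  obtain ⟨C, hC, hlt⟩ := D.exists_isStrongCover_of_monomial (m := m)
    fun x y hxy hh => absurd (hcon x y hxy hh.1) (by omega)
  obtain ⟨x, hx, hle⟩ := mem_powIdeal.mp (h C hC) m hm
  exact absurd (hlt x hx) (by omega)

/-- The associated primes of `I(D)` are the primes generated by strong vertex covers. -/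
theorem mem_associatedPrimes_edgeIdeal_iff {K : Type*} [Field K] {P : Ideal (MvPolynomial V K)} :
    P ∈ associatedPrimes (MvPolynomial V K) (MvPolynomial V K ⧸ D.edgeIdeal K) ↔
      ∃ C, D.IsStrongCover C ∧ P = powIdeal K C 1 := by
  classical
  have hcol : ∀ f g : MvPolynomial V K,
      g ∈ Submodule.colon (⊥ : Submodule (MvPolynomial V K) (MvPolynomial V K ⧸ D.edgeIdeal K))
        {Ideal.Quotient.mk (D.edgeIdeal K) f} ↔ g * f ∈ D.edgeIdeal K := by
    intro f g
    rw [Submodule.mem_colon_singleton, Submodule.mem_bot]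
    exact Ideal.Quotient.eq_zero_iff_mem (a := g * f)
  rw [AssociatedPrimes.mem_iff, isAssociatedPrime_iff]
  constructor
  · rintro ⟨hP, f, rfl⟩
    obtain ⟨f, rfl⟩ := Ideal.Quotient.mk_surjective f
    set P := Submodule.colon (⊥ : Submodule (MvPolynomial V K)
      (MvPolynomial V K ⧸ D.edgeIdeal K)) {Ideal.Quotient.mk (D.edgeIdeal K) f} with hPdef
    let F : Set V → Ideal (MvPolynomial V K) :=
      fun C => Submodule.colon (powIdeal K C (D.coverExp C)) {f}
    have hF : ∀ C g, g ∈ F C ↔ g * f ∈ powIdeal K C (D.coverExp C) := fun C g => by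
      rw [Submodule.mem_colon_singleton, smul_eq_mul]
    have hinf : ((Set.toFinite {C | D.IsStrongCover C}).toFinset).inf F ≤ P := by
      intro g hg
      rw [hPdef, hcol, mem_edgeIdeal_iff_forall_isStrongCover]
      intro C hC
      rw [Submodule.mem_finsetInf] at hg
      exact (hF C g).mp (hg C (by simpa using hC))
    -- A prime containing a finite intersection contains one of its members, here the colon of a
    -- single irreducible component.
    obtain ⟨C, hC, hCP⟩ := hP.inf_le'.mp hinf
    have hC : D.IsStrongCover C := by simpa using hC
    have hfC : f ∉ powIdeal K C (D.coverExp C) := fun h =>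
      hP.ne_top ((Ideal.eq_top_iff_one _).mpr (hCP ((hF C 1).mpr (by rwa [one_mul]))))
    refine ⟨C, hC, le_antisymm (fun g hg => ?_) (powIdeal_one_le_iff.mpr fun x hx => ?_)⟩
    · rw [hPdef, hcol] at hg
      by_contra hgC
      exact mul_notMem_powIdeal hgC hfC (D.edgeIdeal_le_powIdeal hC.1 hg)
    · refine hP.mem_of_pow_mem (D.coverExp C x) (hCP ((hF C _).mpr ?_))
      refine Ideal.mul_mem_right _ _ ?_
      rw [X, monomial_pow, one_pow, monomial_mem_powIdeal]
      exact ⟨x, hx, by simp⟩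
  · rintro ⟨C, hC, rfl⟩
    refine ⟨isPrime_powIdeal_one C, ?_⟩
    -- The socle monomial of the component of `C`: one below each exponent on `C`, and large enough
    -- off `C` to complete any arc.
    let m : V →₀ ℕ := Finsupp.equivFunOnFinite.symm
      fun x => if x ∈ C then D.coverExp C x - 1 else D.weight x
    have hmC : ∀ x ∈ C, m x = D.coverExp C x - 1 := fun x hx => by simp [m, hx]
    have hmZ : ∀ x ∉ C, m x = D.weight x := fun x hx => by simp [m, hx]
    refine ⟨Ideal.Quotient.mk _ (monomial m 1),
      le_antisymm (powIdeal_one_le_iff.mpr fun x hx => ?_) fun g hg => ?_⟩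
    · rw [hcol, X, monomial_mul, one_mul, mem_edgeIdeal]
      intro m' hm'
      rw [support_monomial, if_neg one_ne_zero, Finset.mem_singleton] at hm'
      subst hm'
      have hself : (Finsupp.single x 1 + m : V →₀ ℕ) x = D.coverExp C x := by
        have := D.one_le_coverExp C x
        simp only [Finsupp.add_apply, Finsupp.single_eq_same, hmC x hx]
        omega
      have hle : ∀ y, m y ≤ (Finsupp.single x 1 + m : V →₀ ℕ) y := fun y => by simp
      by_cases h1 : ∃ z, D.Arc x z ∧ z ∉ C
      · obtain ⟨z, hxz, hz⟩ := h1
        refine ⟨x, z, hxz, ?_, ?_⟩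
        · rw [hself]; exact D.one_le_coverExp C x
        · rw [← hmZ z hz]; exact hle z
      have hself' : (Finsupp.single x 1 + m : V →₀ ℕ) x = D.weight x := by
        rw [hself, coverExp, if_neg h1]
      by_cases h2 : ∃ z, D.Arc z x ∧ z ∉ C
      · obtain ⟨z, hzx, hz⟩ := h2
        refine ⟨z, x, hzx, ?_, hself'.ge⟩
        have := hle z
        rw [hmZ z hz] at this
        exact (D.weight_pos z).trans_le this
      -- Only here is strength needed: the out-neighbours of `y` lie in `C`, so `m y = w(y) - 1 ≥
      -- 1`, and the arc `(y, x)` puts the product into `I(D)`.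
      · push Not at h1 h2
        obtain ⟨y, hy, hyx, hw, hyC⟩ := hC.2 x hx fun y hxy =>
          ((D.adj_iff x y).mp hxy).elim (h1 y) (h2 y)
        refine ⟨y, x, hyx, ?_, hself'.ge⟩
        have := hle y
        rw [hmC y hy, coverExp, if_neg (by push Not; exact hyC)] at this
        omega
    · rw [hcol] at hg
      by_contra hgC
      refine mul_notMem_powIdeal hgC ?_ (D.edgeIdeal_le_powIdeal hC.1 hg)
      rw [monomial_mem_powIdeal]
      rintro ⟨x, hx, hle⟩
      have := D.one_le_coverExp C x
      rw [hmC x hx] at hle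
      omega

theorem isUnmixed_edgeIdeal_iff (K : Type*) [Field K] :
    (D.edgeIdeal K).IsUnmixed ↔
      ∀ C C', D.IsStrongCover C → D.IsStrongCover C' → C.ncard = C'.ncard := by
  simp only [Ideal.IsUnmixed, mem_associatedPrimes_edgeIdeal_iff]
  constructor
  · intro h C C' hC hC'
    have := h _ ⟨C, hC, rfl⟩ _ ⟨C', hC', rfl⟩
    rw [height_powIdeal_one, height_powIdeal_one] at this
    exact_mod_cast this
  · rintro h _ ⟨C, hC, rfl⟩ _ ⟨C', hC', rfl⟩
    rw [height_powIdeal_one, height_powIdeal_one, h C C' hC hC']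

end WeightedOrientedGraph

/-! ### From `⋆`-semi-forests to strong covers -/

namespace SimpleGraph.Walk

variable {V : Type*} {G : SimpleGraph V}

/-- A vertex of a cycle has two distinct neighbours along the cycle. -/
theorem IsCycle.exists_two_edges {u x : V} {c : G.Walk u u} (hc : c.IsCycle) (hx : x ∈ c.support) :
    ∃ y z, y ≠ z ∧ s(x, y) ∈ c.edges ∧ s(x, z) ∈ c.edges := by
  have h := hc.ncard_neighborSet_toSubgraph_eq_two hx
  obtain ⟨y, z, hyz, hs⟩ := Set.ncard_eq_two.mp h
  have key : ∀ w, w ∈ c.toSubgraph.neighborSet x → s(x, w) ∈ c.edges := fun w hw => by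
    rwa [← mem_edges_toSubgraph, Subgraph.mem_edgeSet]
  exact ⟨y, z, hyz, key y (by rw [hs]; simp), key z (by rw [hs]; simp)⟩

theorem IsCycle.exists_dart_snd {u x : V} {c : G.Walk u u} (hc : c.IsCycle) (hx : x ∈ c.support) :
    ∃ d ∈ c.darts, d.snd = x := by
  have : x ∈ c.support.tail := by
    rw [← cons_tail_support, List.mem_cons] at hx
    rcases hx with rfl | h
    · exact c.end_mem_tail_support hc.not_nil
    · exact h
  rw [← map_snd_darts, List.mem_map] at this
  exact this

end SimpleGraph.Walk

namespace WeightedOrientedGraph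

variable {V : Type*} [Finite V] (D : WeightedOrientedGraph V)

theorem two_le_deg {H : D.graph.Subgraph} {x y z : V} (hy : H.Adj x y) (hz : H.Adj x z)
    (hyz : y ≠ z) : 2 ≤ D.deg H x := by
  rw [deg, ← Set.ncard_pair hyz]
  refine Set.ncard_le_ncard ?_ (Set.toFinite _)
  rintro w (rfl | rfl)
  exacts [hy, hz]

theorem one_le_deg {H : D.graph.Subgraph} {x y : V} (hy : H.Adj x y) : 1 ≤ D.deg H x :=
  (Set.ncard_pos (Set.toFinite _)).mpr ⟨y, hy⟩

theorem deg_mono {H H' : D.graph.Subgraph} (h : H ≤ H') (x : V) : D.deg H x ≤ D.deg H' x :=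
  Set.ncard_le_ncard (fun _ hy => h.2 hy) (Set.toFinite _)

variable {D} in
/-- The end of a nontrivial oriented path has an in-neighbour which is the start of the path or has
degree at least two. -/
theorem exists_arc_of_isOrientedWalk {B : D.graph.Subgraph} {u x : V}
    (p : B.spanningCoe.Walk u x) (hp : p.IsPath) (ho : D.IsOrientedWalk p) (hux : u ≠ x) :
    ∃ y, B.Adj y x ∧ D.Arc y x ∧ (y = u ∨ 2 ≤ D.deg B y) := by
  induction p with
  | nil => exact absurd rfl hux
  | @cons u b x h q ih =>
    rw [SimpleGraph.Walk.cons_isPath_iff] at hp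
    have hoq : D.IsOrientedWalk q := fun d hd => ho d (by simp [hd])
    have hub : D.Arc u b := ho ⟨(u, b), h⟩ (by simp)
    by_cases hbx : b = x
    · subst hbx
      exact ⟨u, h, hub, Or.inl rfl⟩
    · obtain ⟨y, hyx, hay, rfl | hy⟩ := ih hp.1 hoq hbx
      · refine ⟨y, hyx, hay, Or.inr (D.two_le_deg hyx h.symm ?_)⟩
        rintro rfl
        exact hp.2 (SimpleGraph.Walk.end_mem_support _)
      · exact ⟨y, hyx, hay, Or.inr hy⟩

theorem two_le_deg_of_mem_cycle {B : D.graph.Subgraph} {u x : V} {c : B.spanningCoe.Walk u u}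
    (hc : c.IsCycle) (hx : x ∈ c.support) : 2 ≤ D.deg B x := by
  obtain ⟨y, z, hyz, hy, hz⟩ := hc.exists_two_edges hx
  exact D.two_le_deg (c.adj_of_mem_edges hy) (c.adj_of_mem_edges hz) hyz

variable {D} in
-- On the cycle take the predecessor; off it, the penultimate vertex of an oriented path from the
-- cycle.
theorem IsUnicycle.exists_arc {B : D.graph.Subgraph} (hB : D.IsUnicycle B) {x : V}
    (hx : x ∈ B.verts) : ∃ y, B.Adj y x ∧ D.Arc y x ∧ 2 ≤ D.deg B y := by
  obtain ⟨⟨u, c, hc, -, ho, hr⟩, -⟩ := hB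
  by_cases hxc : x ∈ c.support
  · obtain ⟨d, hd, rfl⟩ := hc.exists_dart_snd hxc
    exact ⟨d.fst, d.adj, ho d hd,
      D.two_le_deg_of_mem_cycle hc (c.dart_fst_mem_support_of_mem_darts hd)⟩
  · obtain ⟨z, hz, p, hp, hpo⟩ := hr x hx hxc
    obtain ⟨y, h1, h2, rfl | h3⟩ := exists_arc_of_isOrientedWalk p hp hpo
      (by rintro rfl; exact hxc hz)
    · exact ⟨y, h1, h2, D.two_le_deg_of_mem_cycle hc hz⟩
    · exact ⟨y, h1, h2, h3⟩

/-- A set containing the vertices of a `⋆`-semi-forest extends to a strong vertex cover. -/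
theorem IsStarSemiForest.exists_isStrongCover {D : WeightedOrientedGraph V}
    {H : D.graph.Subgraph} (hH : D.IsStarSemiForest H) :
    ∃ C, D.IsStrongCover C ∧ H.verts ⊆ C := by
  obtain ⟨r, s, T, v, B, w, W₁, W₂, hT, hB, hHeq, hTT, hBB, hTB, hw, hW, -, hW₁, hW₂, hW₂a, hN⟩ := hH
  have hTH : ∀ i, T i ≤ H := fun i => hHeq ▸ (le_iSup T i).trans le_sup_left
  have hBH : ∀ j, B j ≤ H := fun j => hHeq ▸ (le_iSup B j).trans le_sup_right
  have hadj : ∀ x y, H.Adj x y ↔ (∃ i, (T i).Adj x y) ∨ ∃ j, (B j).Adj x y := by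
    intro x y; simp [hHeq]
  have hverts : ∀ x, x ∈ H.verts ↔ (∃ i, x ∈ (T i).verts) ∨ ∃ j, x ∈ (B j).verts := by
    intro x; simp [hHeq]
  have hdegT : ∀ i x, x ∈ (T i).verts → D.deg H x = D.deg (T i) x := by
    intro i x hx
    unfold deg
    congr 1
    ext y
    rw [SimpleGraph.Subgraph.mem_neighborSet, SimpleGraph.Subgraph.mem_neighborSet, hadj]
    refine ⟨?_, fun h => Or.inl ⟨i, h⟩⟩
    rintro (⟨i', h⟩ | ⟨j, h⟩)
    · by_cases hii : i = i'
      · exact hii ▸ h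
      · exact absurd h.fst_mem (Set.disjoint_left.mp (hTT i i' hii) hx)
    · exact absurd h.fst_mem (Set.disjoint_left.mp (hTB i j) hx)
  have hdegB : ∀ j x, x ∈ (B j).verts → D.deg H x = D.deg (B j) x := by
    intro j x hx
    unfold deg
    congr 1
    ext y
    rw [SimpleGraph.Subgraph.mem_neighborSet, SimpleGraph.Subgraph.mem_neighborSet, hadj]
    refine ⟨?_, fun h => Or.inr ⟨j, h⟩⟩
    rintro (⟨i, h⟩ | ⟨j', h⟩)
    · exact absurd hx (Set.disjoint_left.mp (hTB i j) h.fst_mem)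
    · by_cases hjj : j = j'
      · exact hjj ▸ h
      · exact absurd h.fst_mem (Set.disjoint_left.mp (hBB j j' hjj) hx)
  set A : Set V := W₂ ∪ ({x | x ∈ H.verts ∧ 2 ≤ D.deg H x} ∪ {x | ∃ i, x = v i ∧ D.deg H x = 1})
    with hA
  -- A vertex of weight one has degree at most one in its component, and is a parent only of a
  -- one-vertex tree.
  have hAheavy : ∀ y ∈ A, 1 < D.weight y := by
    have hone : ∀ y, ¬ 1 < D.weight y → D.weight y = 1 := fun y hy => by
      have := D.weight_pos y
      omega
    have htriv : ∀ i, (T i).verts = {v i} → D.deg H (v i) = 0 := by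
      intro i hi
      rw [hdegT i _ (hT i).1, deg, Set.ncard_eq_zero (Set.toFinite _)]
      ext y
      refine ⟨fun h => ?_, fun h => h.elim⟩
      have hy : y ∈ (T i).verts := h.snd_mem
      rw [hi, Set.mem_singleton_iff] at hy
      exact (h.ne hy.symm).elim
    rintro y (hy | ⟨hyH, hy⟩ | ⟨i, rfl, hy⟩)
    · exact hW₂ hy
    · by_contra hlt
      rcases (hverts y).mp hyH with ⟨i, hi⟩ | ⟨j, hj⟩
      · rcases (hT i).2.2.2 y hi (hone y hlt) with ⟨h, -⟩ | ⟨h, rfl⟩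
        · rw [hdegT i y hi] at hy
          omega
        · rw [htriv i h] at hy
          omega
      · have h1 := (hB j).2 y hj (hone y hlt)
        rw [hdegB j y hj] at hy
        omega
    · by_contra hlt
      rcases (hT i).2.2.2 _ (hT i).1 (hone _ hlt) with ⟨-, h⟩ | ⟨h, -⟩
      · exact h rfl
      · rw [htriv i h] at hy
        omega
  -- The complement of this `Z` is the cover; avoiding `N⁺(A)` makes every vertex of `A` usable as a
  -- witness of strength.
  obtain ⟨Z, hW₁Z, hZ⟩ := (Set.toFinite
    {Z : Set V | D.graph.IsIndepSet Z ∧ Disjoint Z H.verts ∧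
      Disjoint Z (D.outNbhd A)}).exists_le_maximal (a := W₁)
    ⟨hW₁, by
      rw [Set.disjoint_left]
      intro x hx
      obtain ⟨i, rfl⟩ : x ∈ Set.range w := hW ▸ Or.inl hx
      exact (hw i).1, by
      rw [disjoint_comm, Set.disjoint_iff_inter_eq_empty]; exact hN⟩
  obtain ⟨hZi, hZH, hZA⟩ := hZ.prop
  have hAin : ∀ x ∈ D.outNbhd A, (∀ y, D.graph.Adj x y → y ∈ Zᶜ) →
      ∃ y ∈ Zᶜ, D.Arc y x ∧ 1 < D.weight y ∧ ∀ z, D.Arc y z → z ∈ Zᶜ := by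
    rintro x ⟨y, hy, hyx⟩ hx
    exact ⟨y, hx y (D.adj_of_arc hyx).symm, hyx, hAheavy y hy,
      fun z hz hzZ => Set.disjoint_left.mp hZA hzZ ⟨y, hy, hz⟩⟩
  refine ⟨Zᶜ, ⟨?_, ?_⟩, fun x hx hxZ => Set.disjoint_left.mp hZH hxZ hx⟩
  · intro x y hxy
    by_contra! h
    simp only [Set.mem_compl_iff, not_not] at h
    exact hZi h.1 h.2 (D.adj_of_arc hxy).ne (D.adj_of_arc hxy)
  · intro x hxZ hx
    refine hAin x ?_ hx
    -- A vertex with no neighbour in `Z` lies in `N⁺(A)`: inside `H` by the shape of trees and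
    -- unicycles, outside `H` because it could otherwise be added to `Z`.
    by_contra hxA
    by_cases hxH : x ∈ H.verts
    · refine hxA ?_
      have hin : ∀ S, S ≤ H → (∃ y, S.Adj y x ∧ D.Arc y x ∧ 2 ≤ D.deg S y) →
          x ∈ D.outNbhd A := by
        rintro S hS ⟨y, h1, h2, h3⟩
        exact ⟨y, Or.inr (Or.inl ⟨(hS.2 h1).fst_mem, h3.trans (D.deg_mono hS y)⟩), h2⟩
      rcases (hverts x).mp hxH with ⟨i, hi⟩ | ⟨j, hj⟩
      · by_cases hxv : x = v i
        · subst hxv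
          rcases (hW.symm ▸ Set.mem_range_self i : w i ∈ W₁ ∪ W₂) with h | h
          · exact absurd (hW₁Z h) (hx _ (hw i).2)
          · exact ⟨w i, Or.inl h, hW₂a i h⟩
        · obtain ⟨p, hp, hpo⟩ := (hT i).2.2.1 x hi hxv
          obtain ⟨y, h1, h2, rfl | h3⟩ := exists_arc_of_isOrientedWalk p hp hpo (Ne.symm hxv)
          · refine ⟨v i, Or.inr ?_, h2⟩
            rcases (D.one_le_deg ((hTH i).2 h1)).eq_or_lt with h | h
            · exact Or.inr ⟨i, rfl, h.symm⟩
            · exact Or.inl ⟨(hTH i).1 (hT i).1, h⟩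
          · exact hin (T i) (hTH i) ⟨y, h1, h2, h3⟩
      · exact hin (B j) (hBH j) ((hB j).exists_arc hj)
    · refine hxZ (hZ.le_of_ge (y := insert x Z) ⟨?_, ?_, ?_⟩ (Set.subset_insert x Z)
        (Set.mem_insert x Z))
      · intro a ha b hb hab hadj'
        rcases ha with rfl | ha <;> rcases hb with rfl | hb
        · exact hab rfl
        · exact hx b hadj' hb
        · exact hx a hadj'.symm ha
        · exact hZi ha hb hab hadj'
      · rw [Set.disjoint_insert_left]
        exact ⟨hxH, hZH⟩
      · rw [Set.disjoint_insert_left]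
        exact ⟨hxA, hZA⟩

end WeightedOrientedGraph

/-! ### Periodic points of self-maps -/

namespace Function

variable {α : Type*} {f : α → α}

/-- After `k` steps from `x`, complete a total of `n * k` steps, a multiple of the period `n`. -/
theorem exists_iterate_eq_of_mem_periodicPts {x y : α} {k : ℕ} (hx : x ∈ periodicPts f)
    (h : f^[k] x = y) : ∃ l, f^[l] y = x := by
  obtain ⟨n, hn, hp⟩ := hx
  refine ⟨n * k - k, ?_⟩
  have hk : k ≤ n * k := Nat.le_mul_of_pos_left k hn
  rw [← h, ← iterate_add_apply, Nat.sub_add_cancel hk]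
  exact hp.mul_const k

theorem exists_iterate_eq_of_common {x x' y : α} {n n' : ℕ}
    (hx' : x' ∈ periodicPts f) (h : f^[n] y = x) (h' : f^[n'] y = x') : ∃ k, f^[k] x = x' := by
  rcases le_total n n' with hle | hle
  · refine ⟨n' - n, ?_⟩
    rw [← h, ← iterate_add_apply, Nat.sub_add_cancel hle, h']
  · refine exists_iterate_eq_of_mem_periodicPts (k := n - n') hx' ?_
    rw [← h', ← iterate_add_apply, Nat.sub_add_cancel hle, h]

theorem exists_iterate_mem_periodicPts [Finite α] (f : α → α) (x : α) :
    ∃ n, f^[n] x ∈ periodicPts f := by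
  obtain ⟨m, n, hmn, h⟩ := Finite.exists_ne_map_eq_of_infinite fun n : ℕ => f^[n] x
  wlog hlt : m < n generalizing m n
  · exact this n m hmn.symm h.symm (by omega)
  refine ⟨m, n - m, by omega, ?_⟩
  change f^[n - m] (f^[m] x) = f^[m] x
  rw [← iterate_add_apply, Nat.sub_add_cancel hlt.le]
  exact h.symm

theorem apply_mem_periodicPts {x : α} (hx : x ∈ periodicPts f) : f x ∈ periodicPts f := by
  obtain ⟨n, hn, h⟩ := hx
  exact ⟨n, hn, h.apply⟩

theorem eq_of_apply_eq_of_mem_periodicPts {x y : α} (hx : x ∈ periodicPts f)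
    (hy : y ∈ periodicPts f) (h : f x = f y) : x = y := by
  obtain ⟨n, hn, hx⟩ := hx
  obtain ⟨m, hm, hy⟩ := hy
  exact hx.eq_of_apply_eq hy hn hm h

/-- The number of iterations of `f` needed to reach a periodic point. -/
noncomputable def preperiod (f : α → α) (x : α) : ℕ := sInf {n | f^[n] x ∈ periodicPts f}

variable [Finite α]

/-- The drop by one makes `preperiod` a height function, used to show that graph cycles contain only
periodic points. -/
theorem preperiod_apply {x : α} (hx : x ∉ periodicPts f) :
    preperiod f x = preperiod f (f x) + 1 := by
  have h1 := Nat.sInf_mem (s := {n | f^[n] x ∈ periodicPts f}) (exists_iterate_mem_periodicPts f x)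
  have h2 := Nat.sInf_mem (s := {n | f^[n] (f x) ∈ periodicPts f})
    (exists_iterate_mem_periodicPts f (f x))
  apply le_antisymm
  · exact Nat.sInf_le h2
  · change _ ≤ sInf _
    rcases hn : sInf {n | f^[n] x ∈ periodicPts f} with _ | n
    · rw [hn] at h1
      exact absurd h1 hx
    · rw [hn] at h1
      exact Nat.succ_le_succ (Nat.sInf_le (s := {n | f^[n] (f x) ∈ periodicPts f}) h1)

theorem preperiod_eq_zero_iff {x : α} : preperiod f x = 0 ↔ x ∈ periodicPts f := by
  constructor
  · intro h
    by_contra hx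
    rw [preperiod_apply hx] at h
    omega
  · exact fun h => Nat.eq_zero_of_le_zero (Nat.sInf_le h)

end Function

/-! ### Components of functional graphs and their cycles -/

namespace WeightedOrientedGraph

open Function

variable {V : Type*} (D : WeightedOrientedGraph V) (f : V → V) (U : Set V)

/-- The subgraph of the vertices of `U` whose `f`-orbits contain `x`, with edges the arcs
`(f y, y)`. -/
def functionalComponent (x : V) : D.graph.Subgraph where
  verts := {y | y ∈ U ∧ ∃ n, f^[n] y = x}
  Adj y z := (y ∈ U ∧ ∃ n, f^[n] y = x) ∧ (z ∈ U ∧ ∃ n, f^[n] z = x) ∧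
    ((f y = z ∧ D.Arc z y) ∨ (f z = y ∧ D.Arc y z))
  adj_sub := by
    rintro y z ⟨-, -, ⟨-, h⟩ | ⟨-, h⟩⟩
    exacts [(D.adj_of_arc h).symm, D.adj_of_arc h]
  edge_vert := fun h => h.1
  symm := ⟨fun y z h => ⟨h.2.1, h.1, h.2.2.symm⟩⟩

variable {D f U}

theorem functionalComponent_adj {x y z : V} :
    (D.functionalComponent f U x).Adj y z ↔ y ∈ (D.functionalComponent f U x).verts ∧
      z ∈ (D.functionalComponent f U x).verts ∧
        ((f y = z ∧ D.Arc z y) ∨ (f z = y ∧ D.Arc y z)) := Iff.rfl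

theorem functionalComponent_subset_of_iterate_eq {x x' : V} {k : ℕ} (h : f^[k] x = x') :
    (D.functionalComponent f U x).verts ⊆ (D.functionalComponent f U x').verts := by
  rintro y ⟨hy, n, hn⟩
  exact ⟨hy, k + n, by rw [iterate_add_apply, hn, h]⟩

theorem functionalComponent_eq_of_verts {x x' : V}
    (h : (D.functionalComponent f U x).verts = (D.functionalComponent f U x').verts) :
    D.functionalComponent f U x = D.functionalComponent f U x' := by
  refine SimpleGraph.Subgraph.ext h ?_
  ext y z
  rw [functionalComponent_adj, functionalComponent_adj, h]

/-- Components of periodic points with a common vertex coincide. -/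
theorem functionalComponent_eq_of_common {x x' y : V} (hx : x ∈ periodicPts f)
    (hx' : x' ∈ periodicPts f) (hy : y ∈ (D.functionalComponent f U x).verts)
    (hy' : y ∈ (D.functionalComponent f U x').verts) :
    D.functionalComponent f U x = D.functionalComponent f U x' := by
  obtain ⟨-, n, hn⟩ := hy
  obtain ⟨-, n', hn'⟩ := hy'
  obtain ⟨k, hk⟩ := exists_iterate_eq_of_common hx' hn hn'
  obtain ⟨l, hl⟩ := exists_iterate_eq_of_common hx hn' hn
  exact functionalComponent_eq_of_verts (Set.Subset.antisymm
    (functionalComponent_subset_of_iterate_eq hk) (functionalComponent_subset_of_iterate_eq hl))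

theorem mem_functionalComponent_of_mem_support {x u : V}
    {c : (D.functionalComponent f U x).spanningCoe.Walk u u} (hc : c.IsCycle) {y : V}
    (hy : y ∈ c.support) : y ∈ (D.functionalComponent f U x).verts := by
  obtain ⟨z, -, -, hz, -⟩ := hc.exists_two_edges hy
  exact (show (D.functionalComponent f U x).Adj y z from c.adj_of_mem_edges hz).fst_mem

/-- The oriented walk from `f^[n] y` to `y` in a functional component. -/
theorem exists_iterate_walk {x y : V} (n : ℕ)
    (h : ∀ i < n, (D.functionalComponent f U x).Adj (f^[i + 1] y) (f^[i] y) ∧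
      D.Arc (f^[i + 1] y) (f^[i] y)) :
    ∃ p : (D.functionalComponent f U x).spanningCoe.Walk (f^[n] y) y, D.IsOrientedWalk p ∧
      p.support = (List.range (n + 1)).reverse.map (f^[·] y) ∧
      ∀ e ∈ p.edges, ∃ i < n, e = s(f^[i + 1] y, f^[i] y) := by
  induction n with
  | zero => exact ⟨SimpleGraph.Walk.nil, by simp [IsOrientedWalk], by simp, by simp⟩
  | succ n ih =>
    obtain ⟨p, hp, hs, he⟩ := ih fun i hi => h i (by omega)
    have hadj : (D.functionalComponent f U x).spanningCoe.Adj (f^[n + 1] y) (f^[n] y) :=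
      (h n (by omega)).1
    refine ⟨SimpleGraph.Walk.cons hadj p, ?_, ?_, ?_⟩
    · intro d hd
      rw [SimpleGraph.Walk.darts_cons, List.mem_cons] at hd
      rcases hd with rfl | hd
      exacts [(h n (by omega)).2, hp d hd]
    · rw [SimpleGraph.Walk.support_cons, hs, List.range_succ (n := n + 1)]
      simp
    · intro e hmem
      rw [SimpleGraph.Walk.edges_cons, List.mem_cons] at hmem
      rcases hmem with rfl | hmem
      · exact ⟨n, by omega, rfl⟩
      · obtain ⟨i, hi, rfl⟩ := he e hmem
        exact ⟨i, by omega, rfl⟩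

variable [Finite V]

/-- All vertices of a cycle of a functional component are periodic. -/
theorem mem_periodicPts_of_mem_cycle {x u : V}
    {c : (D.functionalComponent f U x).spanningCoe.Walk u u} (hc : c.IsCycle) {y : V}
    (hy : y ∈ c.support) : y ∈ periodicPts f := by
  obtain ⟨a, ha, hmax⟩ := Set.exists_max_image {y | y ∈ c.support} (preperiod f)
    (Set.toFinite _) ⟨y, hy⟩
  suffices preperiod f a = 0 by
    rw [← preperiod_eq_zero_iff]
    exact Nat.eq_zero_of_le_zero (this ▸ hmax y hy)
  rw [preperiod_eq_zero_iff]
  by_contra hap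
  -- A cycle neighbour mapped to the non-periodic `a` would have larger preperiod, so both cycle
  -- neighbours of `a` would equal `f a`.
  have key : ∀ b, s(a, b) ∈ c.edges → f a = b := by
    intro b hb
    have hab : (D.functionalComponent f U x).Adj a b := c.adj_of_mem_edges hb
    rcases hab.2.2 with ⟨h, -⟩ | ⟨h, -⟩
    · exact h
    · have hbp : b ∉ periodicPts f := fun hbp => hap (h ▸ apply_mem_periodicPts hbp)
      have h1 := preperiod_apply hbp
      have h2 := hmax b (c.snd_mem_support_of_mem_edges hb)
      rw [h] at h1
      omega
  obtain ⟨b, b', hne, hb, hb'⟩ := hc.exists_two_edges ha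
  exact hne ((key b hb).symm.trans (key b' hb'))

/-- Since `f` is injective on periodic points, the two cycle neighbours of `y` cannot both be
preimages of `y`. -/
theorem apply_edge_mem_of_mem_cycle {x u : V}
    {c : (D.functionalComponent f U x).spanningCoe.Walk u u} (hc : c.IsCycle) {y : V}
    (hy : y ∈ c.support) : s(y, f y) ∈ c.edges := by
  obtain ⟨b, b', hne, hb, hb'⟩ := hc.exists_two_edges hy
  have hab : (D.functionalComponent f U x).Adj y b := c.adj_of_mem_edges hb
  have hab' : (D.functionalComponent f U x).Adj y b' := c.adj_of_mem_edges hb'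
  rcases hab.2.2 with ⟨h, -⟩ | ⟨h, -⟩
  · rwa [h]
  · rcases hab'.2.2 with ⟨h', -⟩ | ⟨h', -⟩
    · rwa [h']
    · exact absurd (eq_of_apply_eq_of_mem_periodicPts
        (mem_periodicPts_of_mem_cycle hc (c.snd_mem_support_of_mem_edges hb))
        (mem_periodicPts_of_mem_cycle hc (c.snd_mem_support_of_mem_edges hb')) (h.trans h'.symm))
        hne

/-- The right-hand side does not involve `c`; this yields the uniqueness of the cycle in
`IsUnicycle`. -/
theorem edgeSet_cycle_functionalComponent {x u : V}
    {c : (D.functionalComponent f U x).spanningCoe.Walk u u} (hc : c.IsCycle) :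
    c.edgeSet = {e | ∃ y, y ∈ periodicPts f ∧ (∃ n, f^[n] y = x) ∧ e = s(y, f y)} := by
  ext e
  constructor
  · induction e with | _ a b =>
    intro he
    have hab : (D.functionalComponent f U x).Adj a b := c.adj_of_mem_edges he
    rcases hab.2.2 with ⟨h, -⟩ | ⟨h, -⟩
    · exact ⟨a, mem_periodicPts_of_mem_cycle hc (c.fst_mem_support_of_mem_edges he), hab.1.2,
        by rw [h]⟩
    · exact ⟨b, mem_periodicPts_of_mem_cycle hc (c.snd_mem_support_of_mem_edges he), hab.2.1.2,
        by rw [h, Sym2.eq_swap]⟩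
  · rintro ⟨y, hy, ⟨n, hn⟩, rfl⟩
    obtain ⟨-, m, hm⟩ := mem_functionalComponent_of_mem_support hc c.start_mem_support
    have hu := mem_periodicPts_of_mem_cycle hc c.start_mem_support
    obtain ⟨l, hl⟩ := exists_iterate_eq_of_mem_periodicPts hy hn
    have key : ∀ k, f^[k] u ∈ c.support := by
      intro k
      induction k with
      | zero => exact c.start_mem_support
      | succ k ih =>
        rw [iterate_succ_apply']
        exact c.snd_mem_support_of_mem_edges (apply_edge_mem_of_mem_cycle hc ih)
    have hyc := key (l + m)
    rw [iterate_add_apply, hm, hl] at hyc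
    exact apply_edge_mem_of_mem_cycle hc hyc

end WeightedOrientedGraph

/-! ### Trees and unicycles from a self-map; from strong covers to `⋆`-semi-forests -/

namespace WeightedOrientedGraph

open Function

variable {V : Type*} {D : WeightedOrientedGraph V} {f : V → V} {U : Set V}

theorem apply_mem_functionalComponent (hU : ∀ y ∈ U, f y ∈ U) {x y : V} (hx : x ∈ periodicPts f)
    (hy : y ∈ (D.functionalComponent f U x).verts) :
    f y ∈ (D.functionalComponent f U x).verts := by
  obtain ⟨hyU, n, hn⟩ := hy
  refine ⟨hU y hyU, ?_⟩
  rcases n with _ | n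
  · obtain rfl : y = x := hn
    exact exists_iterate_eq_of_mem_periodicPts (k := 1) hx rfl
  · exact ⟨n, hn⟩

theorem iterate_mem_functionalComponent (hU : ∀ y ∈ U, f y ∈ U) {x y : V}
    (hx : x ∈ periodicPts f) (hy : y ∈ (D.functionalComponent f U x).verts) (n : ℕ) :
    f^[n] y ∈ (D.functionalComponent f U x).verts := by
  induction n with
  | zero => exact hy
  | succ n ih =>
    rw [iterate_succ_apply']
    exact apply_mem_functionalComponent hU hx ih

theorem exists_iterate_walk_of_ne (hU : ∀ y ∈ U, f y ∈ U)
    (hf : ∀ y ∈ U, f y ≠ y → D.Arc (f y) y) {x y : V} (hx : x ∈ periodicPts f)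
    (hy : y ∈ (D.functionalComponent f U x).verts) (n : ℕ)
    (hn : ∀ i < n, f (f^[i] y) ≠ f^[i] y) :
    ∃ p : (D.functionalComponent f U x).spanningCoe.Walk (f^[n] y) y, D.IsOrientedWalk p ∧
      p.support = (List.range (n + 1)).reverse.map (f^[·] y) ∧
      ∀ e ∈ p.edges, ∃ i < n, e = s(f^[i + 1] y, f^[i] y) := by
  refine exists_iterate_walk n fun i hi => ?_
  have hmem := iterate_mem_functionalComponent hU hx hy i
  have harc := hf _ hmem.1 (hn i hi)
  rw [iterate_succ_apply']
  exact ⟨⟨apply_mem_functionalComponent hU hx hmem, hmem, Or.inr ⟨rfl, harc⟩⟩, harc⟩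

theorem hasOrientedPath_of_walk {B : D.graph.Subgraph} {u v : V} (p : B.spanningCoe.Walk u v)
    (hp : D.IsOrientedWalk p) : D.HasOrientedPath B u v := by
  classical
  exact ⟨p.bypass, p.bypass_isPath, fun d hd => hp d (p.darts_bypass_subset_darts hd)⟩

/-- A vertex with a preimage other than itself is heavy, so `y` has no neighbour besides `f y`. -/
theorem deg_functionalComponent_eq_one (hU : ∀ y ∈ U, f y ∈ U)
    (hf : ∀ y ∈ U, f y ≠ y → D.Arc (f y) y ∧ 1 < D.weight (f y)) {x y : V}
    (hx : x ∈ periodicPts f) (hy : y ∈ (D.functionalComponent f U x).verts) (hfy : f y ≠ y)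
    (hw : D.weight y = 1) : D.deg (D.functionalComponent f U x) y = 1 := by
  rw [deg, Set.ncard_eq_one]
  refine ⟨f y, ?_⟩
  ext z
  constructor
  · rintro ⟨-, hz, ⟨h, -⟩ | ⟨h, harc⟩⟩
    · exact h.symm
    · have := (hf z hz.1 (fun hzz => (D.adj_of_arc harc).ne (h.symm.trans hzz))).2
      rw [h] at this
      omega
  · rintro rfl
    exact ⟨hy, apply_mem_functionalComponent hU hx hy, Or.inl ⟨rfl, (hf y hy.1 hfy).1⟩⟩

theorem iterate_ne_of_not_isFixedPt {x y : V} {n : ℕ} (h : f^[n] y = x) (hx : f x ≠ x) (i : ℕ)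
    (hp : x ∈ periodicPts f) : f (f^[i] y) ≠ f^[i] y := by
  intro hfix
  have hit : ∀ k, f^[k] (f^[i] y) = f^[i] y := fun k => iterate_fixed hfix k
  obtain ⟨l, hl⟩ := exists_iterate_eq_of_common (n := i) (n' := n) hp rfl h
  rw [hit] at hl
  exact hx (hl ▸ hfix)

variable [Finite V]

theorem isRootOrientedTree_functionalComponent (hU : ∀ y ∈ U, f y ∈ U)
    (hf : ∀ y ∈ U, f y ≠ y → D.Arc (f y) y ∧ 1 < D.weight (f y)) {v : V} (hv : v ∈ U)
    (hfv : f v = v) : D.IsRootOrientedTree (D.functionalComponent f U v) v := by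
  classical
  have hper : v ∈ periodicPts f := ⟨1, one_pos, hfv⟩
  have hne : ∀ y, y ≠ v → (∃ n, f^[n] y = v) → f y ≠ y := by
    rintro y hy ⟨n, hn⟩ hfix
    exact hy ((iterate_fixed hfix n).symm.trans hn)
  refine ⟨⟨hv, 0, rfl⟩, ?_, ?_, ?_⟩
  · intro u c hc
    have hall : ∀ y ∈ c.support, y = v := by
      intro y hy
      obtain ⟨-, n, hn⟩ := mem_functionalComponent_of_mem_support hc hy
      obtain ⟨l, hl⟩ := exists_iterate_eq_of_mem_periodicPts
        (mem_periodicPts_of_mem_cycle hc hy) hn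
      rw [iterate_fixed hfv] at hl
      exact hl.symm
    obtain ⟨y, -, -, hy, -⟩ := hc.exists_two_edges c.start_mem_support
    exact (c.adj_of_mem_edges hy).ne ((hall _ c.start_mem_support).trans
      (hall _ (c.snd_mem_support_of_mem_edges hy)).symm)
  · intro y hy hyv
    have hex := hy.2
    -- Stopping at the first visit to `v` keeps every step of the orbit a genuine arc.
    obtain ⟨p, hp, -⟩ := exists_iterate_walk_of_ne hU (fun y hy h => (hf y hy h).1) hper hy
      (Nat.find hex) fun i hi => hne _ (Nat.find_min hex hi)
        (iterate_mem_functionalComponent hU hper hy i).2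
    have := hasOrientedPath_of_walk p hp
    rwa [Nat.find_spec hex] at this
  · intro y hy hw
    by_cases hyv : y = v
    · subst hyv
      refine Or.inr ⟨?_, rfl⟩
      ext z
      refine ⟨fun hz => ?_, fun hz => by rw [hz]; exact hy⟩
      by_contra hzy
      have hex := hz.2
      have hpos : Nat.find hex ≠ 0 := fun h0 => hzy (by
        have := Nat.find_spec hex
        rwa [h0] at this)
      obtain ⟨k, hk⟩ := Nat.exists_eq_succ_of_ne_zero hpos
      have h1 : f^[k] z ≠ y := Nat.find_min hex (by omega)
      have h2 : f (f^[k] z) = y := by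
        rw [← iterate_succ_apply' f, ← hk]
        exact Nat.find_spec hex
      have := (hf _ (iterate_mem_functionalComponent hU hper hz k).1
        (by rw [h2]; exact h1.symm)).2
      rw [h2] at this
      omega
    · exact Or.inl ⟨deg_functionalComponent_eq_one hU hf hper hy (hne y hyv hy.2) hw, hyv⟩

theorem isUnicycle_functionalComponent (hU : ∀ y ∈ U, f y ∈ U)
    (hf : ∀ y ∈ U, f y ≠ y → D.Arc (f y) y ∧ 1 < D.weight (f y)) {x : V} (hx : x ∈ U)
    (hper : x ∈ periodicPts f) (hfx : f x ≠ x) :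
    D.IsUnicycle (D.functionalComponent f U x) := by
  have hxc : x ∈ (D.functionalComponent f U x).verts := ⟨hx, 0, rfl⟩
  have hwalk : ∀ y ∈ (D.functionalComponent f U x).verts, ∀ n, _ := fun y hy n =>
    exists_iterate_walk_of_ne hU (fun y hy h => (hf y hy h).1) hper hy n fun i _ =>
      iterate_ne_of_not_isFixedPt hy.2.choose_spec hfx i hper
  refine ⟨?_, fun y hy hw => deg_functionalComponent_eq_one hU hf hper hy ?_ hw⟩
  · have hpos := minimalPeriod_pos_of_mem_periodicPts hper
    obtain ⟨m, hm⟩ := Nat.exists_eq_succ_of_ne_zero hpos.ne'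
    have hmx : f^[m + 1] x = x := by
      rw [← Nat.succ_eq_add_one, ← hm]
      exact iterate_minimalPeriod
    obtain ⟨p, hpo, hps, hpe⟩ := hwalk x hxc m
    have hinj : ∀ i ≤ m, ∀ j ≤ m, f^[i] x = f^[j] x → i = j := fun i hi j hj h =>
      (iterate_eq_iterate_iff_of_lt_minimalPeriod (by omega) (by omega)).mp h
    have hmem := iterate_mem_functionalComponent hU hper hxc m
    have harc : D.Arc x (f^[m] x) := by
      have := (hf _ hmem.1 (iterate_ne_of_not_isFixedPt (n := 0) rfl hfx m hper)).1
      rwa [← iterate_succ_apply' f, hmx] at this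
    have hadj : (D.functionalComponent f U x).spanningCoe.Adj x (f^[m] x) :=
      ⟨hxc, hmem, Or.inr ⟨by rw [← iterate_succ_apply' f, hmx], harc⟩⟩
    have hcyc : (SimpleGraph.Walk.cons hadj p).IsCycle := by
      rw [SimpleGraph.Walk.cons_isCycle_iff]
      constructor
      · rw [SimpleGraph.Walk.isPath_def, hps]
        refine List.Nodup.map_on ?_ (List.nodup_reverse.mpr List.nodup_range)
        intro i hi j hj h
        simp only [List.mem_reverse, List.mem_range] at hi hj
        exact hinj i (by omega) j (by omega) h
      · intro he
        obtain ⟨i, hi, he⟩ := hpe _ he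
        -- The closing edge could repeat an edge of the path only for period two, which would orient
        -- one edge both ways.
        rcases Sym2.eq_iff.mp he with ⟨h, -⟩ | ⟨h, h'⟩
        · exact absurd (hinj 0 (by omega) (i + 1) (by omega) h) (by omega)
        · obtain rfl := hinj 0 (by omega) i (by omega) h
          obtain rfl := hinj m le_rfl _ (by omega) h'
          exact D.arc_asymm _ _ harc (hf x hx hfx).1
    refine ⟨x, _, hcyc, fun u' c' hc' => ?_, ?_, ?_⟩
    · rw [edgeSet_cycle_functionalComponent hc', edgeSet_cycle_functionalComponent hcyc]
    · intro d hd
      rw [SimpleGraph.Walk.darts_cons, List.mem_cons] at hd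
      rcases hd with rfl | hd
      exacts [harc, hpo d hd]
    · intro y hy _
      obtain ⟨n, hn⟩ := hy.2
      obtain ⟨q, hq, -⟩ := hwalk y hy n
      have := hasOrientedPath_of_walk q hq
      rw [hn] at this
      exact ⟨x, SimpleGraph.Walk.start_mem_support _, this⟩
  · obtain ⟨n, hn⟩ := hy.2
    exact iterate_ne_of_not_isFixedPt hn hfx 0 hper

variable (D) in
/-- The vertices in a strong vertex cover contained in `U` generate a `⋆`-semi-forest. -/
theorem exists_isStarSemiForest {C : Set V} (hC : D.IsStrongCover C) (hUC : U ⊆ C) :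
    ∃ H : D.graph.Subgraph, D.IsStarSemiForest H ∧ U = H.verts := by
  classical
  obtain ⟨g, hg⟩ : ∃ g : V → V, ∀ x ∈ C, (∀ y, D.graph.Adj x y → y ∈ C) →
      g x ∈ C ∧ D.Arc (g x) x ∧ 1 < D.weight (g x) ∧ ∀ z, D.Arc (g x) z → z ∈ C := by
    choose! g hg using hC.2
    exact ⟨g, hg⟩
  -- Vertices whose witness `g x` is unavailable or outside `U` are fixed; these become the parents.
  let f : V → V := fun x => if (∀ y, D.graph.Adj x y → y ∈ C) ∧ g x ∈ U then g x else x
  have hfg : ∀ x, f x ≠ x → (∀ y, D.graph.Adj x y → y ∈ C) ∧ f x = g x := by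
    intro x hx
    by_cases h : (∀ y, D.graph.Adj x y → y ∈ C) ∧ g x ∈ U
    · exact ⟨h.1, if_pos h⟩
    · exact absurd (if_neg h) hx
  have hfU : ∀ x ∈ U, f x ∈ U := by
    intro x hx
    by_cases h : (∀ y, D.graph.Adj x y → y ∈ C) ∧ g x ∈ U
    · rw [show f x = g x from if_pos h]; exact h.2
    · rw [show f x = x from if_neg h]; exact hx
  have hf' : ∀ x ∈ U, f x ≠ x → D.Arc (f x) x ∧ 1 < D.weight (f x) ∧
      ∀ z, D.Arc (f x) z → z ∈ C := by
    intro x hx h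
    obtain ⟨h1, h2⟩ := hfg x h
    rw [h2]
    exact (hg x (hUC hx) h1).2
  have hf : ∀ x ∈ U, f x ≠ x → D.Arc (f x) x ∧ 1 < D.weight (f x) := fun x hx h =>
    ⟨(hf' x hx h).1, (hf' x hx h).2.1⟩
  have hroot : ∀ x ∈ U, f x = x → ∃ w, w ∉ U ∧ D.graph.Adj x w ∧
      (w ∈ C → D.Arc w x ∧ 1 < D.weight w ∧ ∀ z, D.Arc w z → z ∈ C) := by
    intro x hx hfx
    by_cases h : ∀ y, D.graph.Adj x y → y ∈ C
    · obtain ⟨h1, h2, h3⟩ := hg x (hUC hx) h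
      refine ⟨g x, fun hgU => ?_, (D.adj_of_arc h2).symm, fun _ => ⟨h2, h3⟩⟩
      rw [show f x = g x from if_pos ⟨h, hgU⟩] at hfx
      exact (D.adj_of_arc h2).ne hfx
    · push Not at h
      obtain ⟨y, hy, hyC⟩ := h
      exact ⟨y, fun h => hyC (hUC h), hy, fun h => absurd h hyC⟩
  choose! ω hω using hroot
  obtain ⟨r, ⟨e⟩⟩ := Finite.exists_equiv_fin {x | x ∈ U ∧ f x = x}
  -- Indexing by subgraphs, not by periodic points, counts each unicycle once.
  obtain ⟨s, ⟨e'⟩⟩ := Finite.exists_equiv_fin {B : D.graph.Subgraph |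
    ∃ x ∈ U, x ∈ periodicPts f ∧ f x ≠ x ∧ B = D.functionalComponent f U x}
  let v : Fin r → V := fun i => (e.symm i).1
  let T : Fin r → D.graph.Subgraph := fun i => D.functionalComponent f U (v i)
  let B : Fin s → D.graph.Subgraph := fun j => (e'.symm j).1
  have hv : ∀ i, v i ∈ U ∧ f (v i) = v i := fun i => (e.symm i).2
  have hvper : ∀ i, v i ∈ periodicPts f := fun i => ⟨1, one_pos, (hv i).2⟩
  have hvsurj : ∀ x ∈ U, f x = x → ∃ i, v i = x := fun x hx h =>
    ⟨e ⟨x, hx, h⟩, by simp [v]⟩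
  have hB : ∀ j, ∃ x ∈ U, x ∈ periodicPts f ∧ f x ≠ x ∧ B j = D.functionalComponent f U x :=
    fun j => (e'.symm j).2
  have hBsurj : ∀ x ∈ U, x ∈ periodicPts f → f x ≠ x →
      ∃ j, B j = D.functionalComponent f U x := fun x hx hp h =>
    ⟨e' ⟨_, x, hx, hp, h, rfl⟩, by simp [B]⟩
  set H : D.graph.Subgraph := (⨆ i, T i) ⊔ (⨆ j, B j) with hH
  have hHv : U = H.verts := by
    ext y
    have hmem : y ∈ H.verts ↔ (∃ i, y ∈ (T i).verts) ∨ ∃ j, y ∈ (B j).verts := by simp [hH]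
    rw [hmem]
    constructor
    · intro hy
      obtain ⟨n, hn⟩ := exists_iterate_mem_periodicPts f y
      have hnU : f^[n] y ∈ U := Set.MapsTo.iterate (f := f) (s := U) hfU n hy
      by_cases hfix : f (f^[n] y) = f^[n] y
      · obtain ⟨i, hi⟩ := hvsurj _ hnU hfix
        exact Or.inl ⟨i, hy, n, hi.symm⟩
      · obtain ⟨j, hj⟩ := hBsurj _ hnU hn hfix
        exact Or.inr ⟨j, hj ▸ ⟨hy, n, rfl⟩⟩
    · rintro (⟨i, hi⟩ | ⟨j, hj⟩)
      · exact hi.1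
      · obtain ⟨x, -, -, -, hx⟩ := hB j
        rw [hx] at hj
        exact hj.1
  have hHadj : ∀ x y, H.Adj x y → y ∈ U ∧ (f x = y ∨ (f y = x ∧ f y ≠ y)) := by
    intro x y h
    have hcomp : ∃ z, (D.functionalComponent f U z).Adj x y := by
      have : (∃ i, (T i).Adj x y) ∨ ∃ j, (B j).Adj x y := by simpa [hH] using h
      rcases this with ⟨i, hi⟩ | ⟨j, hj⟩
      · exact ⟨_, hi⟩
      · obtain ⟨z, -, -, -, hz⟩ := hB j
        exact ⟨z, hz ▸ hj⟩
    obtain ⟨z, -, hy, ⟨h, -⟩ | ⟨h, ha⟩⟩ := hcomp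
    · exact ⟨hy.1, Or.inl h⟩
    · exact ⟨hy.1, Or.inr ⟨h, fun hh => (D.adj_of_arc ha).ne (h.symm.trans hh)⟩⟩
  have hvω := fun i => hω (v i) (hv i).1 (hv i).2
  refine ⟨H, ⟨r, s, T, v, B, fun i => ω (v i), {x | x ∈ Set.range (fun i => ω (v i)) ∧ x ∉ C},
    {x | x ∈ Set.range (fun i => ω (v i)) ∧ x ∈ C}, ?_, ?_, rfl, ?_, ?_, ?_, ?_, ?_, ?_, ?_, ?_, ?_,
    ?_⟩, hHv⟩
  · exact fun i => isRootOrientedTree_functionalComponent hfU hf (hv i).1 (hv i).2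
  · intro j
    obtain ⟨x, hx, hp, hfx, h⟩ := hB j
    rw [h]
    exact isUnicycle_functionalComponent hfU hf hx hp hfx
  · intro i i' hii
    rw [Set.disjoint_left]
    rintro y ⟨-, n, hn⟩ ⟨-, n', hn'⟩
    obtain ⟨k, hk⟩ := exists_iterate_eq_of_common (hvper i') hn hn'
    rw [iterate_fixed (hv i).2] at hk
    exact hii (e.symm.injective (Subtype.ext hk))
  · intro j j' hjj
    rw [Set.disjoint_left]
    intro y hy hy'
    obtain ⟨x, -, hp, -, h⟩ := hB j
    obtain ⟨x', -, hp', -, h'⟩ := hB j'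
    refine hjj (e'.symm.injective (Subtype.ext ?_))
    change B j = B j'
    rw [h] at hy ⊢
    rw [h'] at hy' ⊢
    exact functionalComponent_eq_of_common hp hp' hy hy'
  · intro i j
    rw [Set.disjoint_left]
    rintro y ⟨-, n, hn⟩ hy'
    obtain ⟨x, -, hp, hfx, h⟩ := hB j
    rw [h] at hy'
    obtain ⟨-, n', hn'⟩ := hy'
    obtain ⟨k, hk⟩ := exists_iterate_eq_of_common hp hn hn'
    rw [iterate_fixed (hv i).2] at hk
    exact hfx (hk ▸ (hv i).2)
  · exact fun i => ⟨hHv ▸ (hvω i).1, (hvω i).2.1⟩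
  · ext x
    simp only [Set.mem_union, Set.mem_ofPred_eq]
    tauto
  · rw [Set.disjoint_left]
    exact fun x h h' => h.2 h'.2
  · intro x hx y hy _ hxy
    rcases (D.adj_iff x y).mp hxy with h | h
    · exact (hC.1 x y h).elim hx.2 hy.2
    · exact (hC.1 y x h).elim hy.2 hx.2
  · rintro _ ⟨⟨i, rfl⟩, hx⟩
    exact ((hvω i).2.2 hx).2.1
  · exact fun i hi => ((hvω i).2.2 hi.2).1
  · rw [Set.eq_empty_iff_forall_notMem]
    rintro z ⟨⟨x, hx, hxz⟩, -, hz⟩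
    -- Each `x` in `H̃` is the image of another vertex, hence a witness of strength, and its
    -- out-neighbours stay in `C`.
    have hchild : ∀ y ∈ U, f y = x → f y ≠ y → z ∈ C := by
      rintro y hy rfl hyy
      exact (hf' y hy hyy).2.2 z hxz
    rcases hx with ⟨⟨i, rfl⟩, hx⟩ | ⟨hxH, hd⟩ | ⟨i, rfl, hd⟩
    · exact hz (((hvω i).2.2 hx).2.2 z hxz)
    · obtain ⟨y, hy, hne⟩ := Set.exists_ne_of_one_lt_ncard (s := H.neighborSet x) hd (f x)
      obtain ⟨hyU, h | ⟨h, h'⟩⟩ := hHadj x y hy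
      · exact hne h.symm
      · exact hz (hchild y hyU h h')
    · obtain ⟨y, hy⟩ := Set.nonempty_of_ncard_ne_zero (s := H.neighborSet (v i))
        (by rw [deg] at hd; omega)
      obtain ⟨hyU, h | ⟨h, h'⟩⟩ := hHadj _ y hy
      · rw [(hv i).2] at h
        exact (show H.Adj (v i) y from hy).ne h
      · exact hz (hchild y hyU h h')

/-- A weighted oriented subgraph has a generating `⋆`-semi-forest if and only if its vertices are
contained in a strong vertex cover. -/
theorem exists_isGeneratingStarSemiForest_iff (S : D.graph.Subgraph) :
    (∃ H : D.graph.Subgraph, D.IsGeneratingStarSemiForest H S) ↔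
      ∃ C, D.IsStrongCover C ∧ S.verts ⊆ C := by
  constructor
  · rintro ⟨H, hH, hS⟩
    rw [hS]
    exact hH.exists_isStrongCover
  · rintro ⟨C, hC, hS⟩
    exact D.exists_isStarSemiForest hC hS

end WeightedOrientedGraph

/-! ### Chordal graphs: simplicial vertices and well-coveredness -/

namespace SimpleGraph

variable {V : Type*} {G : SimpleGraph V}

/-- A shortest walk among those with vertices in `A` is a path without chords. -/
theorem exists_isPath_chordless {A : Set V} {a b : V} 
    (hA : ∃ p : G.Walk a b, ∀ x ∈ p.support, x ∈ A) :
    ∃ p : G.Walk a b, p.IsPath ∧ (∀ x ∈ p.support, x ∈ A) ∧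
      ∀ x ∈ p.support, ∀ y ∈ p.support, G.Adj x y → s(x, y) ∈ p.edges := by
  classical
  have hex : ∃ n, ∃ p : G.Walk a b, p.length = n ∧ ∀ x ∈ p.support, x ∈ A := by
    obtain ⟨p, hp⟩ := hA
    exact ⟨_, p, rfl, hp⟩
  obtain ⟨p, hn, hp⟩ := Nat.find_spec hex
  have hmin : ∀ q : G.Walk a b, (∀ x ∈ q.support, x ∈ A) → p.length ≤ q.length := by
    intro q hq
    rw [hn]
    exact Nat.find_min' hex ⟨q, rfl, hq⟩
  have hpath : p.IsPath := by
    have h1 := hmin p.bypass fun x hx => hp x (p.support_bypass_subset_support hx)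
    rw [← p.bypass_eq_self_of_length_le_length_bypass h1]
    exact p.bypass_isPath
  refine ⟨p, hpath, hp, ?_⟩
  have key : ∀ i j, i < j → j ≤ p.length → G.Adj (p.getVert i) (p.getVert j) →
      s(p.getVert i, p.getVert j) ∈ p.edges := by
    intro i j hij hj hadj
    have h1 := hmin ((p.take i).append (Walk.cons hadj (p.drop j))) (by
      intro x hx
      rw [Walk.mem_support_append_iff, Walk.support_cons, List.mem_cons] at hx
      rcases hx with hx | rfl | hx
      · exact hp x (p.isSubwalk_take i |>.support_subset hx)
      · exact hp _ (p.getVert_mem_support i)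
      · exact hp x (p.isSubwalk_drop j |>.support_subset hx))
    rw [Walk.length_append, Walk.length_cons, Walk.take_length, Walk.drop_length] at h1
    obtain rfl : j = i + 1 := by omega
    exact p.mk_mem_edges_iff_exists.mpr ⟨i, by omega, rfl⟩
  intro x hx y hy hxy
  obtain ⟨i, rfl, hi⟩ := Walk.mem_support_iff_exists_getVert.mp hx
  obtain ⟨j, rfl, hj⟩ := Walk.mem_support_iff_exists_getVert.mp hy
  rcases lt_trichotomy i j with h | rfl | h
  · exact key i j h hj hxy
  · exact absurd rfl hxy.ne
  · rw [Sym2.eq_swap]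
    exact key j i h hi hxy.symm

/-- A chordless path from `a` to `b` of the given kind closes up through `v` to an induced cycle;
its length is three, so the path is a single edge. -/
theorem IsChordalGraph.adj_of_walk (hG : G.IsChordalGraph) {v a b : V} (hva : G.Adj v a)
    (hvb : G.Adj v b) (hab : a ≠ b)
    (hw : ∃ p : G.Walk a b, ∀ x ∈ p.support, x = a ∨ x = b ∨ (x ≠ v ∧ ¬ G.Adj v x)) :
    G.Adj a b := by
  obtain ⟨p, hp, hpA, hch⟩ :=
    exists_isPath_chordless (A := {x | x = a ∨ x = b ∨ (x ≠ v ∧ ¬ G.Adj v x)}) hw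
  have hvp : v ∉ p.support := fun h => by
    rcases hpA v h with rfl | rfl | ⟨h, -⟩
    exacts [hva.ne rfl, hvb.ne rfl, h rfl]
  have hadj : ∀ x ∈ p.support, G.Adj v x → x = a ∨ x = b := fun x hx hvx => by
    rcases hpA x hx with rfl | rfl | ⟨-, h⟩
    exacts [Or.inl rfl, Or.inr rfl, absurd hvx h]
  have hcyc : (Walk.cons hva (p.concat hvb.symm)).IsCycle := by
    rw [Walk.cons_isCycle_iff, Walk.concat_isPath_iff, Walk.edges_concat]
    refine ⟨⟨hp, hvp⟩, fun h => ?_⟩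
    rw [List.concat_eq_append, List.mem_append, List.mem_singleton] at h
    rcases h with h | h
    · exact hvp (p.fst_mem_support_of_mem_edges h)
    · rcases Sym2.eq_iff.mp h with ⟨h, -⟩ | ⟨-, h⟩
      · exact hvb.ne h
      · exact hab h
  have hedge : ∀ x, x = a ∨ x = b → s(v, x) ∈ (Walk.cons hva (p.concat hvb.symm)).edges := by
    rintro x (rfl | rfl)
    · simp
    · simp [Walk.edges_concat, Sym2.eq_swap]
  have hlen := hG v _ hcyc (by
    have hsupp : ∀ x ∈ (Walk.cons hva (p.concat hvb.symm)).support, x = v ∨ x ∈ p.support := by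
      intro x hx
      simp only [Walk.support_cons, Walk.support_concat, List.mem_cons,
        List.mem_append, List.not_mem_nil, or_false] at hx
      tauto
    intro x hx y hy hxy
    rcases hsupp x hx with rfl | hxp
    · rcases hsupp y hy with rfl | hyp
      · exact absurd rfl hxy.ne
      · exact hedge y (hadj y hyp hxy)
    · rcases hsupp y hy with rfl | hyp
      · rw [Sym2.eq_swap]
        exact hedge x (hadj x hxp hxy.symm)
      · simp [Walk.edges_concat, hch x hxp y hyp hxy])
  rw [Walk.length_cons, Walk.length_concat] at hlen
  exact Walk.adj_of_length_eq_one (p := p) (by omega)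

theorem exists_adj_of_maximal_isIndepSet {M : Set V} (hM : Maximal G.IsIndepSet M) {x : V}
    (hx : x ∉ M) : ∃ y ∈ M, G.Adj x y := by
  by_contra! h
  refine hx (hM.le_of_ge (y := insert x M) ?_ (Set.subset_insert x M) (Set.mem_insert x M))
  rintro a (rfl | ha) b (rfl | hb) hab
  · exact absurd rfl hab
  · exact h b hb
  · exact fun h' => h a ha h'.symm
  · exact hM.prop ha hb hab

variable [Finite V]

/-- Dirac's theorem, for induced subgraphs of a chordal graph: there is a simplicial vertex outside
the closed neighbourhood of any given vertex that is not adjacent to all others. -/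
theorem IsChordalGraph.exists_isClique_neighborSet_of_not_adj (hG : G.IsChordalGraph) (A : Set V)
    {v : V} (hv : v ∈ A) (hnu : ∃ a ∈ A, a ≠ v ∧ ¬ G.Adj v a) :
    ∃ u ∈ A, u ≠ v ∧ ¬ G.Adj v u ∧ G.IsClique (A ∩ G.neighborSet u) := by
  induction hn : A.ncard using Nat.strong_induction_on generalizing A v with | _ n ih =>
  obtain ⟨a, haA, hav, hva⟩ := hnu
  set N : Set V := {x | x ∈ A ∧ x ≠ v ∧ ¬ G.Adj v x} with hN
  set C : Set V := {x | ∃ p : G.Walk a x, ∀ y ∈ p.support, y ∈ N} with hC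
  set S : Set V := {s | s ∈ A ∧ G.Adj v s ∧ ∃ c ∈ C, G.Adj s c} with hS
  have hCN : ∀ c ∈ C, c ∈ N := fun c ⟨p, hp⟩ => hp c p.end_mem_support
  have haC : a ∈ C := ⟨Walk.nil, fun y hy => by
    rw [Walk.support_nil, List.mem_singleton] at hy
    exact hy ▸ ⟨haA, hav, hva⟩⟩
  have hclosed : ∀ c ∈ C, ∀ y ∈ A, G.Adj c y → y ∈ C ∪ S := by
    intro c hc y hy hcy
    by_cases hvy : G.Adj v y
    · exact Or.inr ⟨hy, hvy, c, hc, hcy.symm⟩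
    · left
      have hyv : y ≠ v := by
        rintro rfl
        exact (hCN c hc).2.2 hcy.symm
      obtain ⟨p, hp⟩ := hc
      refine ⟨p.concat hcy, fun z hz => ?_⟩
      rw [Walk.support_concat, List.mem_append, List.mem_singleton] at hz
      rcases hz with hz | rfl
      exacts [hp z hz, ⟨hy, hyv, hvy⟩]
  have hSclique : G.IsClique S := by
    rintro s ⟨-, hvs, c, ⟨p, hp⟩, hsc⟩ s' ⟨-, hvs', c', ⟨p', hp'⟩, hsc'⟩ hne
    refine hG.adj_of_walk hvs hvs' hne
      ⟨Walk.cons hsc ((p.reverse.append p').concat hsc'.symm), fun x hx => ?_⟩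
    simp only [Walk.support_cons, Walk.support_concat, List.mem_cons,
      List.mem_append, List.not_mem_nil, or_false, Walk.mem_support_append_iff,
      Walk.support_reverse, List.mem_reverse] at hx
    rcases hx with rfl | (hx | hx) | rfl
    exacts [Or.inl rfl, Or.inr (Or.inr (hp x hx).2), Or.inr (Or.inr (hp' x hx).2),
      Or.inr (Or.inl rfl)]
  have hsub : C ∪ S ⊆ A := by
    rintro x (hx | hx)
    exacts [(hCN x hx).1, hx.1]
  have hlt : (C ∪ S).ncard < n := by
    rw [← hn]
    refine Set.ncard_lt_ncard ⟨hsub, fun h => ?_⟩ (Set.toFinite _)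
    rcases h hv with h | h
    exacts [(hCN v h).2.1 rfl, h.2.1.ne rfl]
  -- `C` is the component of `a` among the non-neighbours of `v`, and `S` its attachment in `N(v)`.
  -- All neighbours in `A` of a vertex of `C` lie in `C ∪ S`, so induction on this smaller set
  -- applies.
  suffices ∃ u ∈ C, G.IsClique ((C ∪ S) ∩ G.neighborSet u) by
    obtain ⟨u, hu, hcl⟩ := this
    exact ⟨u, (hCN u hu).1, (hCN u hu).2.1, (hCN u hu).2.2,
      fun x hx y hy hxy =>
        hcl ⟨hclosed u hu x hx.1 hx.2, hx.2⟩ ⟨hclosed u hu y hy.1 hy.2, hy.2⟩ hxy⟩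
  -- Induct from a base vertex in `S` if one is not joined to everything, else from one in `C`;
  -- either way the vertex found lies in `C`. If neither exists, `C ∪ S` is a clique.
  by_cases h1 : ∃ s ∈ S, ∃ x ∈ C ∪ S, x ≠ s ∧ ¬ G.Adj s x
  · obtain ⟨s, hs, hx⟩ := h1
    obtain ⟨u, hu, hus, hsu, hcl⟩ := ih _ hlt (C ∪ S) (Or.inr hs) hx rfl
    rcases hu with hu | hu
    · exact ⟨u, hu, hcl⟩
    · exact absurd (hSclique hs hu hus.symm) hsu
  push Not at h1
  by_cases h2 : ∃ c ∈ C, ∃ x ∈ C ∪ S, x ≠ c ∧ ¬ G.Adj c x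
  · obtain ⟨c, hc, hx⟩ := h2
    obtain ⟨u, hu, huc, hcu, hcl⟩ := ih _ hlt (C ∪ S) (Or.inl hc) hx rfl
    rcases hu with hu | hu
    · exact ⟨u, hu, hcl⟩
    · exact absurd (h1 u hu c (Or.inl hc) huc.symm).symm hcu
  push Not at h2
  refine ⟨a, haC, fun x hx y hy hxy => ?_⟩
  rcases hx.1 with hx' | hx'
  exacts [h2 x hx' y hy.1 hxy.symm, h1 x hx' y hy.1 hxy.symm]

theorem IsChordalGraph.exists_isClique_neighborSet (hG : G.IsChordalGraph) {A : Set V}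
    (hA : A.Nonempty) : ∃ u ∈ A, G.IsClique (A ∩ G.neighborSet u) := by
  by_cases h : ∃ v ∈ A, ∃ a ∈ A, a ≠ v ∧ ¬ G.Adj v a
  · obtain ⟨v, hv, ha⟩ := h
    obtain ⟨u, hu, -, -, hcl⟩ := hG.exists_isClique_neighborSet_of_not_adj A hv ha
    exact ⟨u, hu, hcl⟩
  · push Not at h
    obtain ⟨v, hv⟩ := hA
    exact ⟨v, hv, fun x hx y hy hxy => h x hx.1 y hy.1 hxy.symm⟩

/-- A chordal graph has a partition into cliques indexed by a stable set. -/
theorem IsChordalGraph.exists_isIndepSet_clique_partition (hG : G.IsChordalGraph) (A : Set V) :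
    ∃ I ⊆ A, G.IsIndepSet I ∧ ∃ q : V → V, (∀ x ∈ A, q x ∈ I) ∧
      ∀ x ∈ A, ∀ y ∈ A, q x = q y → x ≠ y → G.Adj x y := by
  classical
  induction hn : A.ncard using Nat.strong_induction_on generalizing A with | _ n ih =>
  rcases A.eq_empty_or_nonempty with rfl | hA
  · exact ⟨∅, subset_rfl, by simp [IsIndepSet], id, by simp, by simp⟩
  obtain ⟨u, hu, hcl⟩ := hG.exists_isClique_neighborSet hA
  set A' : Set V := {x | x ∈ A ∧ x ≠ u ∧ ¬ G.Adj u x} with hA'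
  have hlt : A'.ncard < n := by
    rw [← hn]
    exact Set.ncard_lt_ncard ⟨fun x hx => hx.1, fun h => (h hu).2.1 rfl⟩ (Set.toFinite _)
  obtain ⟨I, hI, hIi, q, hq, hqc⟩ := ih _ hlt A' rfl
  refine ⟨insert u I, ?_, ?_, fun x => if x ∈ A' then q x else u, ?_, ?_⟩
  · rintro x (rfl | hx)
    exacts [hu, (hI hx).1]
  · rintro x (rfl | hx) y (rfl | hy) hxy
    · exact absurd rfl hxy
    · exact (hI hy).2.2
    · exact fun h => (hI hx).2.2 h.symm
    · exact hIi hx hy hxy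
  · intro x hx
    by_cases h : x ∈ A'
    · simp [h, hq]
    · simp [h]
  · have hu' : ∀ x ∈ A', q x ≠ u := fun x hx h => (hI (hq x hx)).2.1 h
    have hnot : ∀ x ∈ A, x ∉ A' → x = u ∨ G.Adj u x := by
      intro x hx hx'
      by_contra! h
      exact hx' ⟨hx, h⟩
    intro x hx y hy hxy hne
    by_cases hx' : x ∈ A' <;> by_cases hy' : y ∈ A' <;>
      simp only [hx', hy', if_true, if_false] at hxy
    · exact hqc x hx' y hy' hxy hne
    · exact absurd hxy (hu' x hx')
    · exact absurd hxy.symm (hu' y hy')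
    · rcases hnot x hx hx' with rfl | hx''
      · exact (hnot y hy hy').resolve_left hne.symm
      · rcases hnot y hy hy' with rfl | hy''
        · exact hx''.symm
        · exact hcl ⟨hx, hx''⟩ ⟨hy, hy''⟩ hne

variable (G) in
/-- A graph is well-covered if all its maximal stable sets have the same size. -/
def IsWellCovered : Prop :=
  ∀ M M' : Set V, Maximal G.IsIndepSet M → Maximal G.IsIndepSet M' → M.ncard = M'.ncard

theorem IsIndepSet.exists_maximal {I : Set V} (hI : G.IsIndepSet I) :
    ∃ M, I ⊆ M ∧ Maximal G.IsIndepSet M :=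
  (Set.toFinite {M : Set V | G.IsIndepSet M}).exists_le_maximal hI

/-- By well-coveredness every maximal stable set meets every clique of the partition. If each vertex
of the clique of `v` had a neighbour outside it, a minimal outside set dominating the clique would
be stable and extend to a maximal stable set missing it. So some vertex has its closed neighbourhood
inside the clique and is simplicial. -/
theorem IsChordalGraph.isSimplicialGraph (hG : G.IsChordalGraph) (hW : G.IsWellCovered) :
    G.IsSimplicialGraph := by
  intro v
  obtain ⟨I, -, hI, q, hq, hqc⟩ := hG.exists_isIndepSet_clique_partition Set.univ
  have hqc' : ∀ x y, q x = q y → x ≠ y → G.Adj x y := fun x y => hqc x trivial y trivial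
  obtain ⟨M₀, hIM₀, hM₀⟩ := hI.exists_maximal
  have hmeet : ∀ M, Maximal G.IsIndepSet M → ∃ y ∈ M, q y = q v := by
    intro M hM
    have hinj : Set.InjOn q M := by
      intro x hx y hy hxy
      by_contra hne
      exact hM.prop hx hy hne (hqc' x y hxy hne)
    have himg : q '' M = I := by
      refine Set.eq_of_subset_of_ncard_le ?_ ?_ (Set.toFinite _)
      · rintro _ ⟨x, -, rfl⟩
        exact hq x trivial
      · rw [hinj.ncard_image, hW M M₀ hM hM₀]
        exact Set.ncard_le_ncard hIM₀ (Set.toFinite _)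
    have hv : q v ∈ q '' M := himg ▸ hq v trivial
    exact hv
  obtain ⟨x, hxv, hx⟩ : ∃ x, q x = q v ∧ ∀ y, G.Adj x y → q y = q v := by
    by_contra! hcon
    obtain ⟨Z, -, hZ⟩ := (Set.toFinite {Z : Set V | (∀ z ∈ Z, q z ≠ q v) ∧
      ∀ x, q x = q v → ∃ z ∈ Z, G.Adj x z}).exists_le_minimal (a := {z | q z ≠ q v})
      ⟨fun z hz => hz, fun x hx => by
        obtain ⟨y, h1, h2⟩ := hcon x hx
        exact ⟨y, h2, h1⟩⟩
    have hpriv : ∀ z ∈ Z, ∃ x, q x = q v ∧ G.Adj x z ∧ ∀ w ∈ Z, w ≠ z → ¬ G.Adj x w := by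
      intro z hz
      by_contra! h
      refine (hZ.le_of_le (y := Z \ {z}) ⟨fun w hw => hZ.prop.1 w hw.1, fun x hx => ?_⟩
        Set.sdiff_subset hz).2 rfl
      obtain ⟨w, hw, hxw⟩ := hZ.prop.2 x hx
      by_cases hwz : w = z
      · subst hwz
        obtain ⟨w', h1, h2, h3⟩ := h x hx hxw
        exact ⟨w', ⟨h1, h2⟩, h3⟩
      · exact ⟨w, ⟨hw, hwz⟩, hxw⟩
    -- Adjacent `z, z'` with private neighbours `x, y` would form a four-cycle `x z z' y` without
    -- chords.
    have hZi : G.IsIndepSet Z := by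
      intro z hz z' hz' hne hadj
      obtain ⟨x, hx, hxz, hx'⟩ := hpriv z hz
      obtain ⟨y, hy, hyz, hy'⟩ := hpriv z' hz'
      have hxy : x ≠ y := by
        rintro rfl
        exact hy' z hz hne hxz
      refine hx' z' hz' hne.symm (hG.adj_of_walk (v := y) (hqc' y x (hy.trans hx.symm) hxy.symm) hyz
        (by rintro rfl; exact hZ.prop.1 _ hz' hx)
        ⟨Walk.cons hxz (Walk.cons hadj Walk.nil), fun w hw => ?_⟩)
      simp only [Walk.support_cons, Walk.support_nil, List.mem_cons, List.not_mem_nil,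
        or_false] at hw
      rcases hw with rfl | rfl | rfl
      · exact Or.inl rfl
      · refine Or.inr (Or.inr ⟨?_, hy' w hz hne⟩)
        rintro rfl
        exact hZ.prop.1 _ hz hy
      · exact Or.inr (Or.inl rfl)
    obtain ⟨M, hZM, hM⟩ := hZi.exists_maximal
    obtain ⟨y, hy, hyv⟩ := hmeet M hM
    obtain ⟨z, hz, hyz⟩ := hZ.prop.2 y hyv
    exact hM.prop hy (hZM hz) hyz.ne hyz
  have hmem : ∀ y ∈ G.closedNbhd x, q y = q v := by
    rintro y (rfl | hy)
    exacts [hxv, hx y hy]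
  have hsimp : G.IsSimplicialVertex x := fun y hy z hz hyz =>
    hqc' y z ((hmem y hy).trans (hmem z hz).symm) hyz
  by_cases hvx : v = x
  · exact Or.inl (hvx ▸ hsimp)
  · exact Or.inr ⟨x, hqc' v x hxv.symm hvx, hsimp⟩

end SimpleGraph

/-! ### Simplices and stable sets -/

namespace SimpleGraph

variable {V : Type*} {G : SimpleGraph V}

theorem closedNbhd_eq_of_mem {a b : V} (ha : G.IsSimplicialVertex a) (hb : G.IsSimplicialVertex b)
    (hab : b ∈ G.closedNbhd a) : G.closedNbhd a = G.closedNbhd b := by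
  have key : ∀ a b, G.IsSimplicialVertex a → b ∈ G.closedNbhd a →
      G.closedNbhd a ⊆ G.closedNbhd b := by
    intro a b ha hab x hx
    by_cases hxb : x = b
    · exact Or.inl hxb
    · exact Or.inr (ha hab hx (Ne.symm hxb))
  refine Set.Subset.antisymm (key a b ha hab) (key b a hb ?_)
  rcases hab with rfl | h
  exacts [Or.inl rfl, Or.inr h.symm]

theorem IsSimplex.isClique {S : G.Subgraph} (hS : G.IsSimplex S) : G.IsClique S.verts := by
  obtain ⟨a, ha, rfl⟩ := hS
  exact ha

theorem IsSimplex.exists_mem_of_maximal {S : G.Subgraph} (hS : G.IsSimplex S) {M : Set V}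
    (hM : Maximal G.IsIndepSet M) : ∃ x ∈ M, x ∈ S.verts := by
  obtain ⟨a, ha, rfl⟩ := hS
  by_cases haM : a ∈ M
  · exact ⟨a, haM, Or.inl rfl⟩
  · obtain ⟨y, hy, hay⟩ := exists_adj_of_maximal_isIndepSet hM haM
    exact ⟨y, hy, Or.inr hay⟩

theorem IsSimplex.eq_of_mem {S : G.Subgraph} (hS : G.IsSimplex S) {M : Set V}
    (hM : G.IsIndepSet M) {x y : V} (hx : x ∈ M) (hy : y ∈ M) (hxS : x ∈ S.verts)
    (hyS : y ∈ S.verts) : x = y := by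
  by_contra hne
  exact hM hx hy hne (hS.isClique hxS hyS hne)

/-- If the simplices partition the vertices, a stable set has as many elements as there are
simplices that it meets. -/
theorem IsIndepSet.ncard_eq_ncard_isSimplex {M : Set V} (hM : G.IsIndepSet M)
    (hu : ∀ x : V, ∃! S : G.Subgraph, G.IsSimplex S ∧ x ∈ S.verts) :
    M.ncard = {S : G.Subgraph | G.IsSimplex S ∧ ∃ x ∈ M, x ∈ S.verts}.ncard := by
  choose σ hσ hσu using hu
  have hinj : Set.InjOn σ M := fun x hx y hy h =>
    (hσ x).1.eq_of_mem hM hx hy (hσ x).2 (h ▸ (hσ y).2)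
  rw [← hinj.ncard_image]
  congr 1
  ext S
  constructor
  · rintro ⟨x, hx, rfl⟩
    exact ⟨(hσ x).1, x, hx, (hσ x).2⟩
  · rintro ⟨hS, x, hx, hxS⟩
    exact ⟨x, hx, (hσu x S ⟨hS, hxS⟩).symm⟩

variable [Finite V]

/-- In a well-covered simplicial graph each vertex lies in exactly one simplex. -/
theorem IsSimplicialGraph.existsUnique_isSimplex (hG : G.IsSimplicialGraph)
    (hW : G.IsWellCovered) (x : V) : ∃! S : G.Subgraph, G.IsSimplex S ∧ x ∈ S.verts := by
  have hcov : ∀ x, ∃ S : G.Subgraph, G.IsSimplex S ∧ x ∈ S.verts := by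
    intro x
    rcases hG x with h | ⟨u, hxu, hu⟩
    · exact ⟨_, ⟨x, h, rfl⟩, Or.inl rfl⟩
    · exact ⟨_, ⟨u, hu, rfl⟩, Or.inr hxu.symm⟩
  have : Nonempty V := ⟨x⟩
  choose! ρ hρ using fun (S : G.Subgraph) (hS : G.IsSimplex S) => hS
  set 𝒮 : Set G.Subgraph := {S | G.IsSimplex S} with h𝒮
  have hverts : ∀ S ∈ 𝒮, S.verts = G.closedNbhd (ρ S) := fun S hS => by
    conv_lhs => rw [(hρ S hS).2]
    rfl
  have hρeq : ∀ S ∈ 𝒮, ∀ S' ∈ 𝒮, ρ S' ∈ G.closedNbhd (ρ S) → S = S' := by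
    intro S hS S' hS' h
    rw [(hρ S hS).2, (hρ S' hS').2, closedNbhd_eq_of_mem (hρ S hS).1 (hρ S' hS').1 h]
  have hρinj : Set.InjOn ρ 𝒮 := fun S hS S' hS' h => hρeq S hS S' hS' (Or.inl h.symm)
  have hI : G.IsIndepSet (ρ '' 𝒮) := by
    rintro _ ⟨S, hS, rfl⟩ _ ⟨S', hS', rfl⟩ hne h
    exact hne (by rw [hρeq S hS S' hS' (Or.inr h)])
  -- One simplicial vertex per simplex gives a maximal stable set with as many elements as there are
  -- simplices.
  have hImax : Maximal G.IsIndepSet (ρ '' 𝒮) := by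
    refine ⟨hI, fun M hM hIM y hy => ?_⟩
    obtain ⟨S, hS, hyS⟩ := hcov y
    have : y = ρ S := hS.eq_of_mem hM hy (hIM ⟨S, hS, rfl⟩) hyS (by
      rw [hverts S hS]; exact Or.inl rfl)
    exact this ▸ ⟨S, hS, rfl⟩
  obtain ⟨S, hS, hxS⟩ := hcov x
  refine ⟨S, ⟨hS, hxS⟩, fun S' ⟨hS', hxS'⟩ => ?_⟩
  by_contra hne
  obtain ⟨M, hxM, hM⟩ := IsIndepSet.exists_maximal (G := G) (I := {x}) (by simp [IsIndepSet])
  choose! φ hφ using fun (S : G.Subgraph) (hS : G.IsSimplex S) => hS.exists_mem_of_maximal hM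
  -- `M` meets both `S` and `S'` in `x` alone, so `S'` can be spared and `M` is too small.
  have hMφ : M ⊆ φ '' (𝒮 \ {S'}) := by
    intro m hm
    have key : ∀ T ∈ 𝒮, m ∈ T.verts → φ T = m := fun T hT hmT =>
      IsSimplex.eq_of_mem hT hM.prop (hφ T hT).1 hm (hφ T hT).2 hmT
    obtain ⟨T, hT, hmT⟩ := hcov m
    by_cases hTS : T = S'
    · subst hTS
      obtain rfl : m = x := IsSimplex.eq_of_mem hT hM.prop hm (hxM rfl) hmT hxS'
      exact ⟨S, ⟨hS, fun h => hne h.symm⟩, key S hS hxS⟩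
    · exact ⟨T, ⟨hT, hTS⟩, key T hT hmT⟩
  have h1 := (Set.ncard_le_ncard hMφ (Set.toFinite _)).trans (Set.ncard_image_le (Set.toFinite _))
  have h2 := Set.ncard_sdiff_singleton_lt_of_mem (s := 𝒮) (a := S') hS' (Set.toFinite _)
  have h3 := hW M _ hM hImax
  rw [hρinj.ncard_image] at h3
  omega

end SimpleGraph

/-! ### Comparing the sizes of strong covers -/

namespace WeightedOrientedGraph

variable {V : Type*} {D : WeightedOrientedGraph V}

theorem IsStrongCover.isIndepSet_compl {C : Set V} (hC : D.IsStrongCover C) :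
    D.graph.IsIndepSet Cᶜ := by
  intro x hx y hy _ hxy
  rcases (D.adj_iff x y).mp hxy with h | h
  · exact (hC.1 x y h).elim hx hy
  · exact (hC.1 y x h).elim hy hx

/-- Minimal vertex covers are strong. -/
theorem isStrongCover_compl_of_maximal {M : Set V} (hM : Maximal D.graph.IsIndepSet M) :
    D.IsStrongCover Mᶜ := by
  refine ⟨fun x y hxy => ?_, fun x hx hN => ?_⟩
  · by_contra! h
    simp only [Set.mem_compl_iff, not_not] at h
    exact hM.prop h.1 h.2 (D.adj_of_arc hxy).ne (D.adj_of_arc hxy)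
  · obtain ⟨y, hy, hxy⟩ := SimpleGraph.exists_adj_of_maximal_isIndepSet hM hx
    exact absurd hy (hN y hxy)

variable [Finite V]

theorem ncard_compl_eq_ncard_compl_iff {C C' : Set V} :
    C.ncard = C'.ncard ↔ Cᶜ.ncard = C'ᶜ.ncard := by
  have h := Set.ncard_add_ncard_compl C
  have h' := Set.ncard_add_ncard_compl C'
  omega

theorem isWellCovered_of_forall_isStrongCover
    (h : ∀ C C', D.IsStrongCover C → D.IsStrongCover C' → C.ncard = C'.ncard) :
    D.graph.IsWellCovered := by
  intro M M' hM hM'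
  exact ncard_compl_eq_ncard_compl_iff.mpr
    (h _ _ (isStrongCover_compl_of_maximal hM) (isStrongCover_compl_of_maximal hM'))

/-- If the simplices partition the vertices, all strong vertex covers have the same size if and only
if none of them contains a simplex. -/
theorem forall_isStrongCover_ncard_eq_iff
    (hu : ∀ x : V, ∃! S : D.graph.Subgraph, D.graph.IsSimplex S ∧ x ∈ S.verts) :
    (∀ C C', D.IsStrongCover C → D.IsStrongCover C' → C.ncard = C'.ncard) ↔
      ∀ S : D.graph.Subgraph, D.graph.IsSimplex S → ¬ ∃ C, D.IsStrongCover C ∧ S.verts ⊆ C := by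
  constructor
  · rintro h S hS ⟨C, hC, hSC⟩
    obtain ⟨M, -, hM⟩ := SimpleGraph.IsIndepSet.exists_maximal (G := D.graph) (I := ∅)
      (by simp [SimpleGraph.IsIndepSet])
    have h1 := ncard_compl_eq_ncard_compl_iff.mp
      (h C Mᶜ hC (isStrongCover_compl_of_maximal hM))
    rw [compl_compl, hC.isIndepSet_compl.ncard_eq_ncard_isSimplex hu,
      hM.prop.ncard_eq_ncard_isSimplex hu] at h1
    -- The complement of `C` misses `S`, while `M` meets every simplex.
    refine h1.not_lt (Set.ncard_lt_ncard ⟨?_, fun hle => ?_⟩ (Set.toFinite _))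
    · rintro T ⟨hT, -⟩
      exact ⟨hT, hT.exists_mem_of_maximal hM⟩
    · obtain ⟨-, x, hx, hxS⟩ := hle (show S ∈ _ from ⟨hS, hS.exists_mem_of_maximal hM⟩)
      exact hx (hSC hxS)
  · intro h C C' hC hC'
    have key : ∀ C, D.IsStrongCover C → Cᶜ.ncard = {S | D.graph.IsSimplex S}.ncard := by
      intro C hC
      rw [hC.isIndepSet_compl.ncard_eq_ncard_isSimplex hu]
      congr 1
      ext S
      refine ⟨fun hS => hS.1, fun hS => ⟨hS, ?_⟩⟩
      by_contra! hcon
      exact h S hS ⟨C, hC, fun x hx => by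
        by_contra hxC
        exact hcon x hxC hx⟩
    rw [ncard_compl_eq_ncard_compl_iff, key C hC, key C' hC']

end WeightedOrientedGraph

theorem mainTheorem7 {V : Type*} [Finite V] {K : Type*} [Field K] (D : WeightedOrientedGraph V)
    (hG : D.graph.IsSimplicialGraph ∨ D.graph.IsChordalGraph) :
    (D.edgeIdeal K).IsUnmixed ↔
      (∀ x : V, ∃! S : D.graph.Subgraph, D.graph.IsSimplex S ∧ x ∈ S.verts) ∧
      (∀ S : D.graph.Subgraph, D.graph.IsSimplex S →
        ¬ ∃ H : D.graph.Subgraph, D.IsGeneratingStarSemiForest H S) := by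
  simp only [WeightedOrientedGraph.exists_isGeneratingStarSemiForest_iff,
    D.isUnmixed_edgeIdeal_iff K]
  constructor
  · intro h
    have hW := WeightedOrientedGraph.isWellCovered_of_forall_isStrongCover h
    have hS : D.graph.IsSimplicialGraph := hG.elim id fun hc => hc.isSimplicialGraph hW
    have hu := hS.existsUnique_isSimplex hW
    exact ⟨hu, (WeightedOrientedGraph.forall_isStrongCover_ncard_eq_iff hu).mp h⟩
  · rintro ⟨hu, h⟩
    exact (WeightedOrientedGraph.forall_isStrongCover_ncard_eq_iff hu).mpr h
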